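/- **Formulas.** Let formulas of first-order real arithmetic be generated by $$F,G ::= \top \mid \bot \mid p<0 \mid p=0 \mid p\le 0 \mid p\neq 0 \mid F\wedge G \mid F\vee G \mid \neg F \mid \exists F \mid \forall F \mid \exists^n F \mid \forall^n F,$$ with $p\in\mathbb R[X_0,X_1,\dots]$ and $n\in\mathbb N$; variables are de Bruijn indices, so $X_0$ is bound by the innermost quantifier. A valuation is a finite list $\nu$ of reals; a polynomial is evaluated by substituting the $i$-th entry of $\nu$ (counting from $0$) for $X_i$, and $0$ for the variables not covered by $\nu$. The truth value $\mathrm{eval}(F,\nu)$ is the usual one, with $\mathrm{eval}(\forall F,\nu)$ meaning $\mathrm{eval}(F,x\#\nu)$ for all $x\in\mathbb R$ (where $x\#\nu$ is $\nu$ with $x$ prepended), $\mathrm{eval}(\forall^nF,\nu)$ meaning that $F$ is true at every list obtained by prepending $n$ reals to $\nu$, and likewise for $\exists,\exists^n$. **The procedure.** $\mathrm{qe}$ commutes with $\wedge,\vee,\neg$, leaves atoms, $\top$ and $\bot$ unchanged, and $\mathrm{qe}(\forall F)=A(\mathrm{qe}(F))$, $\mathrm{qe}(\exists F)=E(\mathrm{qe}(F))$,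 $\mathrm{qe}(\forall^nF)=A^n(\mathrm{qe}(F))$, $\mathrm{qe}(\exists^nF)=E^n(\mathrm{qe}(F))$, where $E(F)=\neg A(\neg F)$ and $A$ is the following elimination of one universal quantifier from a quantifier-free $F$. 1. List the polynomials $q_1,\dots,q_k$ of $F$, view them as polynomials in $x=X_0$, and lower all variable indices in their coefficients by one. 2. Branch on all sign assumptions ($+,0,-$) on leading coefficients of the $q_i$ in $x$; a leading coefficient that is assumed to be $0$ is dropped and the next one is treated in the same way. A sign that is already assumed in the branch is reused, here and below. From now on $q_i$ denotes the simplified polynomial of the branch. 3. In each branch let $f$ be the product of the $q_i$ that are not identically zero and $p=f\cdot\partial f/\partial x$. Find the sign assignments of $(q_1,\dots,q_k)$ at the roots of $p$ by the matrix equation $Mw=v$, whose columns are possible sign assignments $\sigma_j$, whose rows are pairs $(I_i,J_i)$ of subsets of $\{1,\dots,k\}$, with $M_{ij}=\prod_{\ell\in I_i}(1-\sigma_j(q_\ell)^2)\prod_{\ell\in J_i}\sigma_j(q_\ell)$, and with $v_i$ the Tarski query $N\big(p^2+\sum_{\ell\in I_i}q_\ell^2,\ \prod_{\ell\in J_i}q_\ell\big)$.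 Here $N(g,h)=S^--S^+$, where $S^+$ is the number of sign changes in the leading coefficients $a_1,a_2,\dots$ of the signed pseudo-remainder sequence $g_1=g$, $g_2=g'h$, $g_{i+2}=s_i\,\mathrm{prem}(g_i,g_{i+1})$, and $S^-$ is that in $(-1)^{\deg g_1}a_1,(-1)^{\deg g_2}a_2,\dots$; $s_i=-1$ if $1+\deg g_i-\deg g_{i+1}$ (taken as $0$ when negative) is even, and $s_i$ is minus the leading coefficient of $g_{i+1}$ otherwise; the signs of the leading coefficients are again obtained by branching on sign assumptions; $N=0$ if $g$ is zero in the branch. For one polynomial the rows are $(\emptyset,\emptyset),(\{1\},\emptyset),(\emptyset,\{1\})$ and the columns $+,0,-$; for no polynomial there is the single row $(\emptyset,\emptyset)$ and the single (empty) column. A list of two or more polynomials is split into two halves, and the matrix equations of the halves are combined (Kronecker product), for each pair of branches. Every matrix equation is reduced: one solves $w=M^{-1}v$, deletes the columns with $w_j=0$, and keeps only the rows of the remaining matrix that are not linear combinations of earlier rows. 4. To the sign assignments found in each refined branch add those at $+\infty$ and $-\infty$, read off from the assumed signs of the leading coefficients and the degrees of the $q_i$. 5. $A(F)$ is the disjunction,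 over all refined branches in which every listed sign assignment makes $F$ true, of the conjunction of the sign assumptions of the branch, each written as $c=0$, $c<0$ or $-c<0$. **Theorem.** For every formula $F$ and every valuation $\nu$, $\mathrm{eval}(F,\nu)$ holds if and only if $\mathrm{eval}(\mathrm{qe}(F),\nu)$ holds; that is, $\mathrm{qe}(F)$ is logically equivalent to $F$. -/

import Mathlib

noncomputable section

namespace HybridQE

open Polynomial

/-! ### Formulas of first-order real arithmetic and their semantics -/

/-- Real multivariate polynomials; the variable `X i` is the de Bruijn variable `Var i`. -/
abbrev RealMPoly : Type := MvPolynomial ℕ ℝ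

/-- Univariate polynomials whose coefficients are real multivariate polynomials. -/
abbrev RMPoly : Type := Polynomial RealMPoly

/-- The atoms `p < 0`, `p = 0`, `p ≤ 0`, `p ≠ 0`. -/
inductive Atom : Type where
  | less (p : RealMPoly)
  | eq (p : RealMPoly)
  | leq (p : RealMPoly)
  | neq (p : RealMPoly)

/-- Formulas over atoms in `α`. Quantifiers bind by de Bruijn indices; `exN n F` and `allN n F`
are blocks of `n` quantifiers. -/
inductive Fm (α : Type) : Type where
  | trueF : Fm α
  | falseF : Fm α
  | atom (a : α) : Fm α
  | and (F G : Fm α) : Fm α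
  | or (F G : Fm α) : Fm α
  | neg (F : Fm α) : Fm α
  | exQ (F : Fm α) : Fm α
  | allQ (F : Fm α) : Fm α
  | exN (n : ℕ) (F : Fm α) : Fm α
  | allN (n : ℕ) (F : Fm α) : Fm α

/-- Evaluation of a polynomial at a list of reals: the entry at position `i` is substituted for
`Var i`, and `0` is substituted for the variables that the list does not cover. -/
def evalMPoly (ν : List ℝ) (p : RealMPoly) : ℝ :=
  MvPolynomial.eval (fun i => ν.getD i 0) p

/-- Truth value of an atom. -/
def aEval : Atom → List ℝ → Prop
  | .less p, ν => evalMPoly ν p < 0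
  | .eq p, ν => evalMPoly ν p = 0
  | .leq p, ν => evalMPoly ν p ≤ 0
  | .neq p, ν => evalMPoly ν p ≠ 0

/-- Truth value of a formula. -/
def eval : Fm Atom → List ℝ → Prop
  | .trueF, _ => True
  | .falseF, _ => False
  | .atom a, ν => aEval a ν
  | .and F G, ν => eval F ν ∧ eval G ν
  | .or F G, ν => eval F ν ∨ eval G ν
  | .neg F, ν => ¬ eval F ν
  | .exQ F, ν => ∃ x : ℝ, eval F (x :: ν)
  | .allQ F, ν => ∀ x : ℝ, eval F (x :: ν)
  | .exN n F, ν => ∃ L : List ℝ, L.length = n ∧ eval F (L ++ ν)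
  | .allN n F, ν => ∀ L : List ℝ, L.length = n → eval F (L ++ ν)

/-! ### Sign assumptions -/

/-- Lists of sign assumptions: `(c, s)` assumes that `c` has the sign `s ∈ {-1, 0, 1}`. -/
abbrev Assumps : Type := List (RealMPoly × ℚ)

open scoped Classical in
/-- The first sign that is recorded for `c` in the list, if there is one. -/
def lookupSign (c : RealMPoly) : Assumps → Option ℚ
  | [] => none
  | (c', s) :: t => if c = c' then some s else lookupSign c t

/-! ### Pseudo-remainder sequences with branching -/

/-- `k` steps of pseudo-division by `q`. -/
def pseudoModAux (q : RMPoly) : ℕ → RMPoly → RMPoly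
  | 0, r => r
  | k + 1, r => pseudoModAux q k
      (C q.leadingCoeff * r - C (r.coeff (k + q.natDegree)) * X ^ k * q)

/-- The pseudo-remainder `prem(p, q)`, with
`lc(q) ^ (1 + deg p - deg q) * p = pquo(p, q) * q + prem(p, q)` and `deg prem(p, q) < deg q`
(and `prem(p, q) = p` if `deg p < deg q`). -/
def pseudoMod (p q : RMPoly) : RMPoly :=
  pseudoModAux q (p.natDegree + 1 - q.natDegree) p

/-- The signed pseudo-remainder: `prem(p, q)` multiplied by `-1` if `1 + deg p - deg q` is even,
and by `-lc(q)` otherwise. -/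
def mulPseudoMod (p q : RMPoly) : RMPoly :=
  C (if Even (p.natDegree + 1 - q.natDegree) then -1 else -q.leadingCoeff) * pseudoMod p q

theorem degree_pseudoModAux_lt (q : RMPoly) (hq : q ≠ 0) :
    ∀ (k : ℕ) (r : RMPoly), r.degree < ((k + q.natDegree : ℕ) : WithBot ℕ) →
      (pseudoModAux q k r).degree < q.degree := by
  intro k
  induction k with
  | zero =>
    intro r hr
    rw [degree_eq_natDegree hq]
    simpa [pseudoModAux] using hr
  | succ k ih =>
    intro r hr
    apply ih
    rw [degree_lt_iff_coeff_zero] at hr ⊢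
    intro m hm
    rw [coeff_sub, coeff_C_mul, mul_assoc, coeff_C_mul, coeff_X_pow_mul', if_pos (by omega)]
    rcases Nat.eq_or_lt_of_le hm with h | h
    · have : m - k = q.natDegree := by omega
      rw [this, ← h, coeff_natDegree, mul_comm, sub_self]
    · rw [hr m (by omega), coeff_eq_zero_of_natDegree_lt (by omega : q.natDegree < m - k)]
      simp

theorem degree_mulPseudoMod_lt (p q : RMPoly) (hq : q ≠ 0) :
    (mulPseudoMod p q).degree < q.degree := by
  have h : (mulPseudoMod p q).degree ≤ (pseudoMod p q).degree := by
    unfold mulPseudoMod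
    rw [← smul_eq_C_mul]
    exact degree_smul_le _ _
  refine lt_of_le_of_lt h (degree_pseudoModAux_lt q hq _ p ?_)
  refine lt_of_le_of_lt degree_le_natDegree ?_
  exact_mod_cast (by omega : p.natDegree < p.natDegree + 1 - q.natDegree + q.natDegree)

open scoped Classical in
/-- Signed pseudo-remainder sequences of `p` and `q`, one for each branch of sign assumptions on
the leading coefficients that are met. The leading coefficient of `p` is assumed to be nonzero in
the given branch. If the leading coefficient of `q` is assumed to vanish, then the leading
monomial of `q` is dropped (`eraseLead`). -/
def spmodsAux (p q : RMPoly) (a : Assumps) : List (Assumps × List RMPoly) :=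
  if hq : q = 0 then [(a, [p])]
  else
    match lookupSign q.leadingCoeff a with
    | none =>
        spmodsAux p q.eraseLead ((q.leadingCoeff, 0) :: a) ++
        (spmodsAux q (mulPseudoMod p q) ((q.leadingCoeff, 1) :: a)).map
          (fun b => (b.1, p :: b.2)) ++
        (spmodsAux q (mulPseudoMod p q) ((q.leadingCoeff, -1) :: a)).map
          (fun b => (b.1, p :: b.2))
    | some s =>
        if s = 0 then spmodsAux p q.eraseLead a
        else (spmodsAux q (mulPseudoMod p q) a).map (fun b => (b.1, p :: b.2))
termination_by q.degree
decreasing_by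
  all_goals first
    | exact degree_eraseLead_lt hq
    | exact degree_mulPseudoMod_lt _ _ hq

open scoped Classical in
/-- Signed pseudo-remainder sequences of `p` and `q` in all branches, where the true leading
coefficient of `p` is determined by branching as well. -/
def spmods (p q : RMPoly) (a : Assumps) : List (Assumps × List RMPoly) :=
  if hp : p = 0 then [(a, [])]
  else
    match lookupSign p.leadingCoeff a with
    | none =>
        spmods p.eraseLead q ((p.leadingCoeff, 0) :: a) ++
        spmodsAux p q ((p.leadingCoeff, 1) :: a) ++
        spmodsAux p q ((p.leadingCoeff, -1) :: a)
    | some s => if s = 0 then spmods p.eraseLead q a else spmodsAux p q a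
termination_by p.degree
decreasing_by
  all_goals exact degree_eraseLead_lt hp

/-! ### Multivariate Tarski queries -/

/-- Number of adjacent pairs of opposite sign. -/
def adjacentChanges : List ℚ → ℕ
  | s :: t :: l => (if s * t < 0 then 1 else 0) + adjacentChanges (t :: l)
  | _ => 0

/-- Number of sign changes in a list, where zeros are ignored. -/
def signChanges (l : List ℚ) : ℕ := adjacentChanges (l.filter (fun s => s ≠ 0))

/-- The number `S⁻ - S⁺` of a remainder sequence, computed from the degrees of its members and
the signs of their leading coefficients that are recorded in the assumptions. -/
def tarskiOfSeq (a : Assumps) (ps : List RMPoly) : ℚ :=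
  (signChanges (ps.map fun p => (-1) ^ p.natDegree * (lookupSign p.leadingCoeff a).getD 0) : ℚ) -
    (signChanges (ps.map fun p => (lookupSign p.leadingCoeff a).getD 0) : ℚ)

/-- The Tarski queries `N(p² + ∑ q_i², ∏ q_j)` (`q_i` in the list `I`, `q_j` in the list `J`)
together with the branches of assumptions that they are subject to. -/
def tarskiQueries (p : RMPoly) (a : Assumps) (I J : List RMPoly) : List (Assumps × ℚ) :=
  let f := p ^ 2 + (I.map (fun q => q ^ 2)).sum
  (spmods f (derivative f * J.prod) a).map (fun b => (b.1, tarskiOfSeq b.1 b.2))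

/-! ### The multivariate matrix equation -/

/-- A matrix equation, given by its list of pairs `(I, J)` of index sets (the rows) and its list
of possible sign assignments (the columns). -/
structure MatrixEq : Type where
  subsets : List (List ℕ × List ℕ)
  signs : List (List ℚ)

/-- The matrix with entries `∏_{ℓ ∈ I_i} (1 - σ_j(q_ℓ)²) * ∏_{ℓ ∈ J_i} σ_j(q_ℓ)`. -/
def signMatrix (S : List (List ℕ × List ℕ)) (T : List (List ℚ)) :
    Matrix (Fin S.length) (Fin T.length) ℚ :=
  Matrix.of fun i j =>
    ((S.get i).1.map fun l => 1 - (T.get j).getD l 0 ^ 2).prod *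
      ((S.get i).2.map fun l => (T.get j).getD l 0).prod

/-- The right-hand sides `(N(I_i, J_i))_i`, with the branches of assumptions that they are
subject to; the assumptions accumulate along the list of rows. -/
def rhsVectors (p : RMPoly) (qs : List RMPoly) :
    List (List ℕ × List ℕ) → Assumps → List (Assumps × List ℚ)
  | [], a => [(a, [])]
  | (I, J) :: S, a =>
      (tarskiQueries p a (I.map fun l => qs.getD l 0) (J.map fun l => qs.getD l 0)).flatMap
        fun b => (rhsVectors p qs S b.1).map fun c => (c.1, b.2 :: c.2)

/-- The solution `w = M⁻¹ v` of the matrix equation `M w = v`, where `M` is square. -/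
def MatrixEq.solve (E : MatrixEq) (v : List ℚ) : Fin E.signs.length → ℚ :=
  if h : E.signs.length = E.subsets.length then
    ((signMatrix E.subsets E.signs).submatrix (Fin.cast h) id)⁻¹.mulVec (fun i => v.getD i 0)
  else 0

open scoped Classical in
/-- The reduction step: keep only the sign assignments `σ_j` with `w_j ≠ 0`, and keep only those
rows of the remaining matrix that are not linear combinations of earlier rows (that is, the
pivot positions in the row reduction of the transposed matrix). -/
def MatrixEq.reduce (E : MatrixEq) (w : Fin E.signs.length → ℚ) : MatrixEq :=
  let T := ((List.finRange E.signs.length).filter (fun j => w j ≠ 0)).map E.signs.get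
  let M := signMatrix E.subsets T
  { subsets := ((List.finRange E.subsets.length).filter
      (fun i => M.row i ∉ Submodule.span ℚ (M.row '' {k | k < i}))).map E.subsets.get
    signs := T }

/-- Solve a matrix equation for `p` and `qs` in every branch and reduce it. -/
def reduceSystem (p : RMPoly) (qs : List RMPoly) (a : Assumps) (E : MatrixEq) :
    List (Assumps × MatrixEq) :=
  (rhsVectors p qs E.subsets a).map fun b => (b.1, E.reduce (E.solve b.2))

/-- The matrix equation for no polynomial: `M = (1)`, and the right-hand side counts the roots
of `p`. -/
def emptyCase : MatrixEq where
  subsets := [([], [])]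
  signs := [[]]

/-- The matrix equation for a single polynomial: all three signs are possible. -/
def baseCase : MatrixEq where
  subsets := [([], []), ([0], []), ([], [0])]
  signs := [[1], [0], [-1]]

/-- Combination of a matrix equation for `n` polynomials with one for further polynomials; its
matrix is the Kronecker product of the two matrices. -/
def combine (n : ℕ) (E₁ E₂ : MatrixEq) : MatrixEq where
  subsets := E₁.subsets.flatMap fun s => E₂.subsets.map fun t =>
    (s.1 ++ t.1.map (fun l => l + n), s.2 ++ t.2.map (fun l => l + n))
  signs := E₁.signs.flatMap fun s => E₂.signs.map fun t => s ++ t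

/-- The matrix equations for the signs of `qs` at the roots of `p`, in branches of assumptions
that extend `a`: the list `qs` is halved, and the reduced matrix equations for the two halves are
combined and reduced again. -/
def calculateData (p : RMPoly) (qs : List RMPoly) (a : Assumps) : List (Assumps × MatrixEq) :=
  if h : qs.length ≤ 1 then
    reduceSystem p qs a (if qs.length = 0 then emptyCase else baseCase)
  else
    let n := qs.length / 2
    let left := calculateData p (qs.take n) a
    let right := calculateData p (qs.drop n) a
    left.flatMap fun b => right.flatMap fun c =>
      reduceSystem p qs (b.1 ++ c.1) (combine n b.2 c.2)
termination_by qs.length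
decreasing_by
  all_goals simp only [List.length_take, List.length_drop]
  all_goals omega

/-! ### Sign determination -/

open scoped Classical in
/-- Branching on the sign of the leading coefficient of `q`. Each branch carries the simplified
polynomial, whose leading coefficient is assumed to be nonzero, or which is zero. -/
def lcAssumps (q : RMPoly) (a : Assumps) : List (Assumps × RMPoly) :=
  if hq : q = 0 then [(a, 0)]
  else
    match lookupSign q.leadingCoeff a with
    | none =>
        ((q.leadingCoeff, 1) :: a, q) :: ((q.leadingCoeff, -1) :: a, q) ::
          lcAssumps q.eraseLead ((q.leadingCoeff, 0) :: a)
    | some s => if s = 0 then lcAssumps q.eraseLead a else [(a, q)]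
termination_by q.degree
decreasing_by
  all_goals exact degree_eraseLead_lt hq

/-- Branching on the signs of the leading coefficients of all polynomials of a list. -/
def lcAssumpsList : List RMPoly → Assumps → List (Assumps × List RMPoly)
  | [], a => [(a, [])]
  | q :: qs, a =>
      (lcAssumps q a).flatMap fun b => (lcAssumpsList qs b.1).map fun c => (c.1, b.2 :: c.2)

open scoped Classical in
/-- `p = (∏ q_i) * ∂/∂x (∏ q_i)`, where the product is over the `q_i` that are not identically
zero in the branch. -/
def polyP (qs : List RMPoly) : RMPoly :=
  let f := (qs.filter (fun q => q ≠ 0)).prod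
  f * derivative f

open scoped Classical in
/-- Signs of the (simplified) polynomials at `+∞`: the signs of the leading coefficients. -/
def posLimit (a : Assumps) (qs : List RMPoly) : List ℚ :=
  qs.map fun q => (if q = 0 then 0 else (lookupSign q.leadingCoeff a).getD 0)

open scoped Classical in
/-- Signs of the (simplified) polynomials at `-∞`. -/
def negLimit (a : Assumps) (qs : List RMPoly) : List ℚ :=
  qs.map fun q =>
    (if q = 0 then 0 else (-1) ^ q.natDegree * (lookupSign q.leadingCoeff a).getD 0)

/-- Sign determination: branches of assumptions, each with its list of sign assignments to `qs`,
namely those at `+∞`, at `-∞` and at the roots of `polyP`. -/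
def signDetermination (qs : List RMPoly) (a : Assumps) : List (Assumps × List (List ℚ)) :=
  (lcAssumpsList qs a).flatMap fun b =>
    (calculateData (polyP b.2) b.2 b.1).map fun c =>
      (c.1, posLimit b.1 b.2 :: negLimit b.1 b.2 :: c.2.signs)

/-! ### Quantifier elimination -/

/-- The polynomial of an atom. -/
def Atom.poly : Atom → RealMPoly
  | .less p => p
  | .eq p => p
  | .leq p => p
  | .neq p => p

/-- The list of the polynomials of a formula. -/
def extractPolys : Fm Atom → List RealMPoly
  | .trueF => []
  | .falseF => []
  | .atom a => [a.poly]
  | .and F G => extractPolys F ++ extractPolys G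
  | .or F G => extractPolys F ++ extractPolys G
  | .neg F => extractPolys F
  | .exQ F => extractPolys F
  | .allQ F => extractPolys F
  | .exN _ F => extractPolys F
  | .allN _ F => extractPolys F

/-- A multivariate polynomial, viewed as a univariate polynomial in `Var x` whose coefficients
are polynomials in the other variables. -/
def univariateIn (x : ℕ) (p : RealMPoly) : RMPoly :=
  MvPolynomial.aeval (fun i => if i = x then (X : RMPoly) else C (MvPolynomial.X i)) p

/-- Lowering all variable indices by `1` (for polynomials in which `Var 0` does not occur). -/
def lowerPoly : RealMPoly →ₐ[ℝ] RealMPoly := MvPolynomial.rename (fun i => i - 1)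

/-- Truth value of an atom, given the sign of its polynomial. -/
def Atom.holdsAt : Atom → ℚ → Prop
  | .less _, s => s < 0
  | .eq _, s => s = 0
  | .leq _, s => s ≤ 0
  | .neq _, s => s ≠ 0

/-- Truth value of a quantifier-free formula, given a list of signs of polynomials; `none` if
the formula has a quantifier or a polynomial whose sign is not in the list. -/
def lookupSem : Fm Atom → List (RealMPoly × ℚ) → Option Prop
  | .trueF, _ => some True
  | .falseF, _ => some False
  | .atom a, l => (lookupSign a.poly l).map a.holdsAt
  | .and F G, l => (lookupSem F l).bind fun P => (lookupSem G l).map fun Q => P ∧ Q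
  | .or F G, l => (lookupSem F l).bind fun P => (lookupSem G l).map fun Q => P ∨ Q
  | .neg F, l => (lookupSem F l).map fun P => ¬ P
  | .exQ _, _ => none
  | .allQ _, _ => none
  | .exN _ _, _ => none
  | .allN _ _, _ => none

/-- The atom that expresses a sign assumption. -/
def assumpToAtom (b : RealMPoly × ℚ) : Atom :=
  if b.2 = 0 then .eq b.1 else if b.2 < 0 then .less b.1 else .less (-b.1)

/-- The conjunction of a list of sign assumptions. -/
def assumpsToFm : Assumps → Fm Atom
  | [] => .trueF
  | b :: t => .and (.atom (assumpToAtom b)) (assumpsToFm t)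

/-- The disjunction of a list of branches. -/
def disjunction : List Assumps → Fm Atom
  | [] => .falseF
  | a :: t => .or (assumpsToFm a) (disjunction t)

open scoped Classical in
/-- Elimination of the universal quantifier in `∀ Var 0, F`, for quantifier-free `F`: the
disjunction of all branches in which every sign assignment satisfies `F`. -/
def elimForall (F : Fm Atom) : Fm Atom :=
  let qs := extractPolys F
  let univQs := qs.map (univariateIn 0)
  let reindexedUnivQs := univQs.map (Polynomial.map lowerPoly.toRingHom)
  let data := signDetermination reindexedUnivQs []
  disjunction ((data.filter fun b =>
    ∀ s ∈ b.2, ∃ P : Prop, lookupSem F (qs.zip s) = some P ∧ P).map Prod.fst)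

/-- Elimination of the existential quantifier in `∃ Var 0, F`, for quantifier-free `F`. -/
def elimExist (F : Fm Atom) : Fm Atom := .neg (elimForall (.neg F))

/-- The quantifier elimination procedure: quantifiers are eliminated from the inside out. -/
def qe : Fm Atom → Fm Atom
  | .trueF => .trueF
  | .falseF => .falseF
  | .atom a => .atom a
  | .and F G => .and (qe F) (qe G)
  | .or F G => .or (qe F) (qe G)
  | .neg F => .neg (qe F)
  | .exQ F => elimExist (qe F)
  | .allQ F => elimForall (qe F)
  | .exN n F => elimExist^[n] (qe F)
  | .allN n F => elimForall^[n] (qe F)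

end HybridQE

end

/-! Fix a valuation `ν`. It turns every coefficient into a real number and every polynomial over the
coefficients into a real polynomial (`specialize`). The branches form a finite family of assumption
lists, and at least one of them is true at `ν`. In any branch true at `ν`, the listed sign
assignments are exactly those realized on the real line (`isBranching_signDetermination`). The test
made in such a branch is therefore equivalent to the universally quantified formula
(`eval_elimForall`). As the output is quantifier-free, induction on the formula does the rest.
`IsBranching` is the invariant that carries "some branch is true, and true branches have correct
data" through all the constructions.

Finitely many points suffice because, between neighbouring roots of the product `f` of the nonzero
polynomials, Rolle gives a root of `f'`, while beyond all roots the leading coefficients decide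
(`exists_sample_point`).

Signs at the roots are counted by Tarski queries. The Cauchy index of `g' h / g` is the sum of the
signs of `h` at the roots of `g` (`cauchyIndex_derivative_mul`). The indices of `q / p` and `p / q`
add up to the total crossing number of `p q`, which depends only on the signs at both infinities,
and passing to a negative remainder flips the sign of the jumps (`cauchyIndex_step`). The sign
change counts of remainder sequences obey the same recursion (`tarskiOfSeq_cons_cons`).

The numbers of roots with each sign assignment solve the matrix equation. The solution is unique
because invertibility survives Kronecker products (`MatrixEq.Valid.combine`), deletion of columns
and the greedy choice of rows (`MatrixEq.Valid.reduce_solve`). -/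

noncomputable section

namespace HybridQE

open Polynomial

/-! ### Signs of real numbers -/

/-- The sign of a real number, as a rational number. -/
def sgn : ℝ →*₀ ℚ := SignType.castHom.comp signHom

theorem sgn_of_pos {x : ℝ} (h : 0 < x) : sgn x = 1 := by
  simp [sgn, signHom, SignType.castHom, sign_pos h]

theorem sgn_of_neg {x : ℝ} (h : x < 0) : sgn x = -1 := by
  change ((SignType.sign x : SignType) : ℚ) = -1
  rw [sign_neg h]
  rfl

theorem sgn_eq_zero_iff {x : ℝ} : sgn x = 0 ↔ x = 0 := map_eq_zero sgn

theorem sgn_cases (x : ℝ) : (x < 0 ∧ sgn x = -1) ∨ (x = 0 ∧ sgn x = 0) ∨ (0 < x ∧ sgn x = 1) := by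
  rcases lt_trichotomy x 0 with h | h | h
  · exact Or.inl ⟨h, sgn_of_neg h⟩
  · exact Or.inr (Or.inl ⟨h, by rw [h, map_zero]⟩)
  · exact Or.inr (Or.inr ⟨h, sgn_of_pos h⟩)

theorem sgn_neg_one : sgn (-1) = -1 := sgn_of_neg (by norm_num)

theorem sgn_sq_of_ne_zero {x : ℝ} (h : x ≠ 0) : sgn x ^ 2 = 1 := by
  rcases sgn_cases x with ⟨_, e⟩ | ⟨e, _⟩ | ⟨_, e⟩
  · rw [e]; norm_num
  · exact absurd e h
  · rw [e]; norm_num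

theorem one_sub_sgn_sq (x : ℝ) [Decidable (x = 0)] :
    1 - sgn x ^ 2 = if x = 0 then 1 else 0 := by
  split_ifs with h
  · simp [h]
  · simp [sgn_sq_of_ne_zero h]

theorem sgn_eval_of_roots_lt {p : ℝ[X]} {x : ℝ} (h : ∀ y, p.IsRoot y → y < x) :
    sgn (p.eval x) = sgn p.leadingCoeff := by
  rcases sgn_cases p.leadingCoeff with ⟨e, e'⟩ | ⟨e, _⟩ | ⟨e, e'⟩
  · rw [e', sgn_of_neg (eval_lt_zero_of_roots_lt_of_leadingCoeff_nonpos h e.le)]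
  · rw [leadingCoeff_eq_zero.1 e]; simp
  · rw [e', sgn_of_pos (zero_lt_eval_of_roots_lt_of_leadingCoeff_nonneg h e.le)]

theorem sgn_eval_of_lt_roots {p : ℝ[X]} {x : ℝ} (h : ∀ y, p.IsRoot y → x < y) :
    sgn (p.eval x) = (-1) ^ p.natDegree * sgn p.leadingCoeff := by
  have h' : ∀ y, (p.comp (-X)).IsRoot y → y < -x := by
    intro y hy
    have := h (-y) (by simpa [IsRoot, eval_comp] using hy)
    linarith
  have := sgn_eval_of_roots_lt h'
  simp only [eval_comp, eval_neg, eval_X, neg_neg] at this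
  rw [this, comp_neg_X_leadingCoeff_eq, map_mul, map_pow, sgn_neg_one]

/-! ### Local signs and crossings of a polynomial -/

/-- The sign of `p` immediately to the right of `a`. -/
def rightSign (p : ℝ[X]) (a : ℝ) : ℚ :=
  sgn ((p /ₘ (X - C a) ^ p.rootMultiplicity a).eval a)

theorem rootMultiplicity_pow_mul {u : ℝ[X]} {a : ℝ} (m : ℕ) (hu : u.eval a ≠ 0) :
    ((X - C a) ^ m * u).rootMultiplicity a = m := by
  have hu0 : u ≠ 0 := by rintro rfl; simp at hu
  rw [mul_comm, rootMultiplicity_mul_X_sub_C_pow hu0, rootMultiplicity_eq_zero hu, zero_add]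

theorem rightSign_pow_mul {u : ℝ[X]} {a : ℝ} (m : ℕ) (hu : u.eval a ≠ 0) :
    rightSign ((X - C a) ^ m * u) a = sgn (u.eval a) := by
  rw [rightSign, rootMultiplicity_pow_mul m hu,
    mul_divByMonic_cancel_left u ((monic_X_sub_C a).pow m)]

theorem exists_eq_pow_mul {p : ℝ[X]} (hp : p ≠ 0) (a : ℝ) :
    ∃ u : ℝ[X], p = (X - C a) ^ p.rootMultiplicity a * u ∧ u.eval a ≠ 0 ∧
      rightSign p a = sgn (u.eval a) :=
  ⟨_, (pow_mul_divByMonic_rootMultiplicity_eq p a).symm,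
    eval_divByMonic_pow_rootMultiplicity_ne_zero a hp, rfl⟩

@[simp] theorem rightSign_zero (a : ℝ) : rightSign 0 a = 0 := by simp [rightSign]

theorem rightSign_of_not_isRoot {p : ℝ[X]} {a : ℝ} (h : p.eval a ≠ 0) :
    rightSign p a = sgn (p.eval a) := by
  simpa using rightSign_pow_mul 0 h

theorem rightSign_mul (p q : ℝ[X]) (a : ℝ) :
    rightSign (p * q) a = rightSign p a * rightSign q a := by
  rcases eq_or_ne p 0 with rfl | hp
  · simp
  rcases eq_or_ne q 0 with rfl | hq
  · simp
  obtain ⟨u, hu, hu0, hu1⟩ := exists_eq_pow_mul hp a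
  obtain ⟨v, hv, hv0, hv1⟩ := exists_eq_pow_mul hq a
  have huv : p * q = (X - C a) ^ (p.rootMultiplicity a + q.rootMultiplicity a) * (u * v) := by
    conv_lhs => rw [hu, hv]
    ring
  rw [hu1, hv1, huv, rightSign_pow_mul _ (by simp [hu0, hv0]), eval_mul, map_mul]

theorem rightSign_eq_sgn_leadingCoeff {p : ℝ[X]} (hp : p ≠ 0) {a : ℝ}
    (h : ∀ y, p.IsRoot y → y ≤ a) : rightSign p a = sgn p.leadingCoeff := by
  obtain ⟨u, hu, hu0, hu1⟩ := exists_eq_pow_mul hp a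
  have hl : p.leadingCoeff = u.leadingCoeff := by
    conv_lhs => rw [hu]
    rw [leadingCoeff_mul, ((monic_X_sub_C a).pow _).leadingCoeff, one_mul]
  rw [hu1, hl]
  refine sgn_eval_of_roots_lt fun y hy => lt_of_le_of_ne (h y ?_) ?_
  · rw [hu, IsRoot, eval_mul, hy.eq_zero, mul_zero]
  · rintro rfl
    exact hu0 hy

/-- Half the increment of the sign of `p` at `a`. -/
def crossing (p : ℝ[X]) (a : ℝ) : ℚ :=
  (1 - (-1) ^ p.rootMultiplicity a) / 2 * rightSign p a

@[simp] theorem crossing_zero (a : ℝ) : crossing 0 a = 0 := by simp [crossing]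

theorem crossing_of_not_isRoot {p : ℝ[X]} {a : ℝ} (h : ¬ p.IsRoot a) : crossing p a = 0 := by
  simp [crossing, rootMultiplicity_eq_zero h]

theorem crossing_mul {p q : ℝ[X]} (hp : p ≠ 0) (hq : q ≠ 0) (a : ℝ) :
    crossing (p * q) a = (1 - (-1) ^ (p.rootMultiplicity a + q.rootMultiplicity a)) / 2 *
      (rightSign p a * rightSign q a) := by
  rw [crossing, rootMultiplicity_mul (mul_ne_zero hp hq), rightSign_mul]

/-- The sign of `p` changes only by crossings, so they sum to half the difference of its signs at
the two infinities. Induction on the degree avoids ordering the roots: a largest root `a` is split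
off. The factor `X - a` is negative at all other roots and so negates their crossings; at `a` it
raises the multiplicity by one, which replaces the crossing by the right sign of the cofactor minus
that crossing. -/
theorem sum_crossing (n : ℕ) : ∀ (p : ℝ[X]), p ≠ 0 → p.natDegree = n → ∀ A : Finset ℝ,
    (∀ x, p.IsRoot x → x ∈ A) → ∑ x ∈ A, crossing p x =
      (sgn p.leadingCoeff - (-1) ^ p.natDegree * sgn p.leadingCoeff) / 2 := by
  induction n with
  | zero =>
    intro p hp hn A _
    rw [eq_C_of_natDegree_eq_zero hn]
    simp [crossing]
  | succ n ih =>
    intro p hp hn A hA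
    by_cases hr : ∃ x, p.IsRoot x
    · have hne : p.roots.toFinset.Nonempty := by
        obtain ⟨x, hx⟩ := hr
        exact ⟨x, by simpa [hp] using hx⟩
      set a := p.roots.toFinset.max' hne with ha
      have hamem : p.IsRoot a := by
        have := p.roots.toFinset.max'_mem hne
        simpa [hp] using this
      have hmax : ∀ y, p.IsRoot y → y ≤ a := fun y hy =>
        Finset.le_max' _ _ (by simpa [hp] using hy)
      clear_value a
      obtain ⟨r, rfl⟩ := dvd_iff_isRoot.2 hamem
      have hr0 : r ≠ 0 := right_ne_zero_of_mul hp
      have hx0 : (X - C a) ≠ 0 := X_sub_C_ne_zero a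
      have hroot : ∀ y, r.IsRoot y → ((X - C a) * r).IsRoot y := fun y hy => by
        rw [IsRoot, eval_mul, hy.eq_zero, mul_zero]
      have hdeg : r.natDegree = n := by
        rw [natDegree_mul hx0 hr0, natDegree_X_sub_C] at hn
        omega
      have hIH := ih r hr0 hdeg A fun x hx => hA x (hroot x hx)
      have hra : rightSign r a = sgn r.leadingCoeff :=
        rightSign_eq_sgn_leadingCoeff hr0 fun y hy => hmax y (hroot y hy)
      have haA : a ∈ A := hA a hamem
      have hterm : ∀ x ∈ A, crossing ((X - C a) * r) x =
          -crossing r x + if x = a then rightSign r a else 0 := by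
        intro x _
        rw [crossing_mul hx0 hr0]
        split_ifs with hxa
        · subst hxa
          have h1 : rightSign (X - C x) x = 1 := by
            have := rightSign_pow_mul (u := 1) (a := x) 1 (by simp)
            simpa using this
          rw [rootMultiplicity_X_sub_C_self, h1, crossing]
          ring
        · have h0 : (X - C a).eval x ≠ 0 := by simpa [sub_eq_zero] using hxa
          rw [rootMultiplicity_eq_zero h0, rightSign_of_not_isRoot h0, crossing, zero_add, add_zero]
          by_cases hxr : r.IsRoot x
          · have hlt : (X - C a).eval x < 0 := by
              simpa using lt_of_le_of_ne (hmax x (hroot x hxr)) hxa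
            rw [sgn_of_neg hlt]
            ring
          · simp [rootMultiplicity_eq_zero hxr]
      rw [Finset.sum_congr rfl hterm, Finset.sum_add_distrib, Finset.sum_neg_distrib, hIH,
        Finset.sum_ite_eq' A a, if_pos haA, hra, leadingCoeff_mul, leadingCoeff_X_sub_C, one_mul,
        natDegree_mul hx0 hr0, natDegree_X_sub_C]
      ring
    -- Without roots, the sign at any one point, here `0`, equals the signs at both infinities.
    · push Not at hr
      rw [Finset.sum_eq_zero fun x _ => crossing_of_not_isRoot (hr x)]
      have h1 : sgn (p.eval 0) = _ := sgn_eval_of_roots_lt fun y hy => absurd hy (hr y)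
      have h2 : sgn (p.eval 0) = _ := sgn_eval_of_lt_roots fun y hy => absurd hy (hr y)
      rw [← h2, h1, sub_self, zero_div]

/-! ### Cauchy indices -/

/-- The jump of the rational function `q / p` at `a`. -/
def jump (q p : ℝ[X]) (a : ℝ) : ℚ :=
  if q.rootMultiplicity a < p.rootMultiplicity a then crossing (p * q) a else 0

theorem jump_of_not_isRoot {q p : ℝ[X]} {a : ℝ} (h : ¬ p.IsRoot a) : jump q p a = 0 := by
  simp [jump, rootMultiplicity_eq_zero h]

/-- At most one of the two quotients has a pole at `a`. If neither has, the multiplicities agree, so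
`p * q` vanishes to even order and does not cross. -/
theorem jump_add_jump {p q : ℝ[X]} (hp : p ≠ 0) (hq : q ≠ 0) (a : ℝ) :
    jump q p a + jump p q a = crossing (p * q) a := by
  unfold jump
  rcases lt_trichotomy (q.rootMultiplicity a) (p.rootMultiplicity a) with h | h | h
  · rw [if_pos h, if_neg (by omega), add_zero]
  · rw [if_neg (by omega), if_neg (by omega), crossing_mul hp hq, h, Even.neg_one_pow ⟨_, rfl⟩]
    simp
  · rw [if_neg (by omega), if_pos h, zero_add, mul_comm q p]

/-- Where `q` vanishes to higher order than `p`, the term `d * q` is negligible and the remainder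
behaves like `-c * p`. Elsewhere the order of `q` divides both terms, so neither quotient has a
pole. -/
theorem jump_sub_mul {p q : ℝ[X]} (hp : p ≠ 0) (hq : q ≠ 0) (d : ℝ[X]) {c : ℝ} (hc : 0 < c)
    (a : ℝ) : jump (d * q - C c * p) q a = -jump p q a := by
  unfold jump
  rcases lt_or_ge (p.rootMultiplicity a) (q.rootMultiplicity a) with h | h
  · obtain ⟨u, hu, hu0, hu1⟩ := exists_eq_pow_mul hp a
    obtain ⟨v, hv, -, -⟩ := exists_eq_pow_mul hq a
    obtain ⟨k, hk⟩ : ∃ k, q.rootMultiplicity a = p.rootMultiplicity a + (k + 1) :=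
      ⟨q.rootMultiplicity a - p.rootMultiplicity a - 1, by omega⟩
    set w := d * (X - C a) ^ (k + 1) * v - C c * u with hw
    have he : d * q - C c * p = (X - C a) ^ p.rootMultiplicity a * w := by
      conv_lhs => rw [hu, hv, hk]
      rw [hw]
      ring
    have hwa : w.eval a = -c * u.eval a := by simp [hw]
    have hw0 : w.eval a ≠ 0 := by
      rw [hwa]
      exact mul_ne_zero (by linarith) hu0
    have hm : (d * q - C c * p).rootMultiplicity a = p.rootMultiplicity a := by
      rw [he, rootMultiplicity_pow_mul _ hw0]
    have hs : rightSign (d * q - C c * p) a = -rightSign p a := by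
      rw [he, rightSign_pow_mul _ hw0, hwa, map_mul, sgn_of_neg (by linarith), hu1, neg_one_mul]
    have hr0 : d * q - C c * p ≠ 0 := by
      rw [he]
      refine mul_ne_zero (pow_ne_zero _ (X_sub_C_ne_zero a)) ?_
      rintro h0
      simp [h0] at hw0
    rw [if_pos (by omega), if_pos h, crossing_mul hq hr0, crossing_mul hq hp, hm, hs]
    ring
  · rw [if_neg (by omega : ¬ p.rootMultiplicity a < q.rootMultiplicity a), neg_zero]
    rcases eq_or_ne (d * q - C c * p) 0 with h0 | h0
    · simp [h0]
    · have hdvd : (X - C a) ^ q.rootMultiplicity a ∣ d * q - C c * p :=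
        dvd_sub (dvd_mul_of_dvd_right (pow_rootMultiplicity_dvd q a) _)
          (dvd_mul_of_dvd_right ((pow_dvd_pow _ h).trans (pow_rootMultiplicity_dvd p a)) _)
      rw [if_neg (not_lt.2 ((le_rootMultiplicity_iff h0).2 hdvd))]

/-- The Cauchy index of the rational function `q / p`. -/
def cauchyIndex (q p : ℝ[X]) : ℚ := ∑ x ∈ p.roots.toFinset, jump q p x

@[simp] theorem cauchyIndex_zero_left (p : ℝ[X]) : cauchyIndex 0 p = 0 := by
  simp [cauchyIndex, jump]

theorem cauchyIndex_eq_sum {q p : ℝ[X]} {A : Finset ℝ} (hp : p ≠ 0)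
    (hA : ∀ x, p.IsRoot x → x ∈ A) : cauchyIndex q p = ∑ x ∈ A, jump q p x := by
  refine Finset.sum_subset (fun x hx => hA x ?_) fun x _ hx => jump_of_not_isRoot ?_
  · simpa [hp] using hx
  · simpa [hp] using hx

/-- The step of the Euclidean algorithm for Cauchy indices. -/
theorem cauchyIndex_step {p q : ℝ[X]} (hp : p ≠ 0) (hq : q ≠ 0) (d : ℝ[X]) {c : ℝ}
    (hc : 0 < c) : cauchyIndex q p = cauchyIndex (d * q - C c * p) q +
      (sgn p.leadingCoeff * sgn q.leadingCoeff -
        (-1) ^ p.natDegree * sgn p.leadingCoeff * ((-1) ^ q.natDegree * sgn q.leadingCoeff)) / 2 := by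
  have hpq := mul_ne_zero hp hq
  set A := (p * q).roots.toFinset with hA
  have hmem : ∀ x, (p * q).IsRoot x → x ∈ A := fun x hx => by
    rw [hA, Multiset.mem_toFinset, mem_roots hpq]
    exact hx
  have hpA : ∀ x, p.IsRoot x → x ∈ A := fun x hx => hmem x (by simp [IsRoot, hx.eq_zero])
  have hqA : ∀ x, q.IsRoot x → x ∈ A := fun x hx => hmem x (by simp [IsRoot, hx.eq_zero])
  have hsum := sum_crossing _ (p * q) hpq rfl A hmem
  rw [Finset.sum_congr rfl fun x _ => (jump_add_jump hp hq x).symm, Finset.sum_add_distrib,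
    ← cauchyIndex_eq_sum hp hpA, natDegree_mul hp hq, leadingCoeff_mul, map_mul] at hsum
  rw [cauchyIndex_eq_sum hq hqA, Finset.sum_congr rfl fun x _ => jump_sub_mul hp hq d hc x,
    Finset.sum_neg_distrib]
  linear_combination hsum

/-- Differentiation lowers the multiplicity by exactly one and multiplies the leading local factor
by it. If `h` does not vanish at `a`, then `g * g' * h` has odd order there, and the local sign of
`g` enters squared. If `h` vanishes, it cancels the simple pole of `g' / g`. -/
theorem jump_derivative_mul {g : ℝ[X]} (hg : g ≠ 0) (h : ℝ[X]) {a : ℝ} (ha : g.IsRoot a) :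
    jump (derivative g * h) g a = sgn (h.eval a) := by
  obtain ⟨u, hu, hu0, hu1⟩ := exists_eq_pow_mul hg a
  obtain ⟨m, hm⟩ : ∃ m, g.rootMultiplicity a = m + 1 :=
    ⟨g.rootMultiplicity a - 1, by have := (rootMultiplicity_pos hg).2 ha; omega⟩
  set w := C ((m : ℝ) + 1) * u + (X - C a) * derivative u with hw
  have he : derivative g = (X - C a) ^ m * w := by
    conv_lhs => rw [hu, hm]
    rw [derivative_mul, derivative_X_sub_C_pow, hw]
    simp
    ring
  have hwa : w.eval a = ((m : ℝ) + 1) * u.eval a := by simp [hw]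
  have hw0 : w.eval a ≠ 0 := by
    rw [hwa]
    exact mul_ne_zero (by positivity) hu0
  by_cases hh : h.eval a = 0
  · rw [hh, map_zero, jump]
    rcases eq_or_ne (derivative g * h) 0 with h0 | h0
    · simp [h0]
    · refine if_neg (not_lt.2 ((le_rootMultiplicity_iff h0).2 ?_))
      rw [hm, pow_succ, he]
      exact mul_dvd_mul (dvd_mul_right _ _) (dvd_iff_isRoot.2 hh)
  · have hwh : (w * h).eval a ≠ 0 := by
      rw [eval_mul]
      exact mul_ne_zero hw0 hh
    have he' : derivative g * h = (X - C a) ^ m * (w * h) := by rw [he, mul_assoc]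
    have hm' : (derivative g * h).rootMultiplicity a = m := by
      rw [he', rootMultiplicity_pow_mul _ hwh]
    have h0 : derivative g * h ≠ 0 := by
      rw [he']
      refine mul_ne_zero (pow_ne_zero _ (X_sub_C_ne_zero a)) ?_
      intro h0
      simp [h0] at hwh
    rw [jump, if_pos (by omega), crossing_mul hg h0, hm', hm, hu1, he', rightSign_pow_mul _ hwh,
      eval_mul, hwa, map_mul, map_mul, sgn_of_pos (by positivity : (0 : ℝ) < m + 1)]
    have hodd : Odd (m + 1 + m) := ⟨m, by ring⟩
    rw [hodd.neg_one_pow]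
    linear_combination sgn (h.eval a) * sgn_sq_of_ne_zero hu0

/-- The Sturm–Tarski theorem, in terms of the Cauchy index. -/
theorem cauchyIndex_derivative_mul {g : ℝ[X]} (hg : g ≠ 0) (h : ℝ[X]) :
    cauchyIndex (derivative g * h) g = ∑ x ∈ g.roots.toFinset, sgn (h.eval x) :=
  Finset.sum_congr rfl fun x hx => jump_derivative_mul hg h (by simpa [hg] using hx)

/-! ### Branching on sign assumptions -/

/-- Evaluation of the coefficients at a valuation, as a ring homomorphism. -/
def evalHom (ν : List ℝ) : RealMPoly →+* ℝ := MvPolynomial.eval fun i => ν.getD i 0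

/-- Specialization of the coefficients of a univariate polynomial at a valuation. -/
def specialize (ν : List ℝ) : RMPoly →+* ℝ[X] := mapRingHom (evalHom ν)

/-- The sign assumptions hold at the valuation. -/
def Consistent (ν : List ℝ) (a : Assumps) : Prop := ∀ b ∈ a, b.2 = sgn (evalHom ν b.1)

/-- All assumed signs are among `-1, 0, 1`. -/
def ProperSigns (a : Assumps) : Prop := ∀ b ∈ a, b.2 = 0 ∨ b.2 = 1 ∨ b.2 = -1

/-- The leading coefficient of `p` is assumed to be nonzero. -/
def LeadAssumedNonzero (a : Assumps) (p : RMPoly) : Prop := ∃ s ≠ 0, (p.leadingCoeff, s) ∈ a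

theorem Consistent.mono {ν : List ℝ} {a b : Assumps} (h : Consistent ν b) (hab : a ⊆ b) :
    Consistent ν a := fun x hx => h x (hab hx)

theorem LeadAssumedNonzero.mono {a b : Assumps} {p : RMPoly} (h : LeadAssumedNonzero a p)
    (hab : a ⊆ b) : LeadAssumedNonzero b p :=
  let ⟨s, hs, hm⟩ := h
  ⟨s, hs, hab hm⟩

theorem mem_of_lookupSign {c : RealMPoly} {s : ℚ} : ∀ {a : Assumps},
    lookupSign c a = some s → (c, s) ∈ a
  | [], h => by simp [lookupSign] at h
  | (c', s') :: t, h => by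
    rw [lookupSign] at h
    split_ifs at h with hc
    · simp_all
    · exact List.mem_cons_of_mem _ (mem_of_lookupSign h)

theorem exists_lookupSign_of_mem {c : RealMPoly} {s : ℚ} : ∀ {a : Assumps},
    (c, s) ∈ a → ∃ s', lookupSign c a = some s'
  | [], h => by simp at h
  | (c', s') :: t, h => by
    rw [lookupSign]
    split_ifs with hc
    · exact ⟨s', rfl⟩
    · refine exists_lookupSign_of_mem ((List.mem_cons.1 h).resolve_left fun e => hc ?_)
      exact congrArg Prod.fst e

/-- Lists joined from two branches may record the same polynomial twice, even with conflicting
signs. Consistency forces every record to be the true sign, so it does not matter which one is found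
first. -/
theorem Consistent.lookupSign_eq {ν : List ℝ} {a : Assumps} (h : Consistent ν a) {c : RealMPoly}
    {s : ℚ} (hm : (c, s) ∈ a) : lookupSign c a = some (sgn (evalHom ν c)) := by
  obtain ⟨s', hs'⟩ := exists_lookupSign_of_mem hm
  rw [hs']
  exact congrArg some (h _ (mem_of_lookupSign hs'))

theorem LeadAssumedNonzero.lookupSign_eq {ν : List ℝ} {a : Assumps} {p : RMPoly}
    (h : LeadAssumedNonzero a p) (hc : Consistent ν a) :
    lookupSign p.leadingCoeff a = some (sgn (evalHom ν p.leadingCoeff)) :=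
  let ⟨_, _, hm⟩ := h
  hc.lookupSign_eq hm

theorem LeadAssumedNonzero.eval_ne_zero {ν : List ℝ} {a : Assumps} {p : RMPoly}
    (h : LeadAssumedNonzero a p) (hc : Consistent ν a) : evalHom ν p.leadingCoeff ≠ 0 := by
  obtain ⟨s, hs, hm⟩ := h
  intro h0
  have := hc _ hm
  simp only [h0, map_zero] at this
  exact hs this

theorem leadingCoeff_specialize {ν : List ℝ} {p : RMPoly} (h : evalHom ν p.leadingCoeff ≠ 0) :
    (specialize ν p).leadingCoeff = evalHom ν p.leadingCoeff :=
  leadingCoeff_map_of_leadingCoeff_ne_zero _ h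

theorem natDegree_specialize {ν : List ℝ} {p : RMPoly} (h : evalHom ν p.leadingCoeff ≠ 0) :
    (specialize ν p).natDegree = p.natDegree :=
  natDegree_map_of_leadingCoeff_ne_zero _ h

theorem specialize_ne_zero {ν : List ℝ} {p : RMPoly} (h : evalHom ν p.leadingCoeff ≠ 0) :
    specialize ν p ≠ 0 := by
  rw [← leadingCoeff_ne_zero, leadingCoeff_specialize h]
  exact h

theorem specialize_C (ν : List ℝ) (c : RealMPoly) : specialize ν (C c) = C (evalHom ν c) := by
  simp [specialize]

theorem specialize_eraseLead {ν : List ℝ} {p : RMPoly} (h : evalHom ν p.leadingCoeff = 0) :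
    specialize ν p.eraseLead = specialize ν p := by
  conv_rhs => rw [← eraseLead_add_C_mul_X_pow p]
  rw [map_add, map_mul, specialize_C, h]
  simp

/-- `L` is a list of branches that refine the assumptions `a`: one of them holds at `ν` if `a`
does, and `Q` holds for the data of those that do. -/
structure IsBranching {β : Type} (ν : List ℝ) (a : Assumps) (L : List (Assumps × β))
    (Q : Assumps → β → Prop) : Prop where
  exists_consistent : Consistent ν a → ∃ b ∈ L, Consistent ν b.1
  subset : ∀ b ∈ L, a ⊆ b.1
  proper : ∀ b ∈ L, ProperSigns a → ProperSigns b.1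
  correct : ∀ b ∈ L, Consistent ν b.1 → Q b.1 b.2

namespace IsBranching

variable {β γ : Type} {ν : List ℝ} {a : Assumps}

theorem pure {x : β} {Q : Assumps → β → Prop} (h : Consistent ν a → Q a x) :
    IsBranching ν a [(a, x)] Q where
  exists_consistent := fun hc => ⟨_, List.mem_singleton_self _, hc⟩
  subset := by simp
  proper := by simp
  correct := by simpa using h

theorem imp {L : List (Assumps × β)} {Q Q' : Assumps → β → Prop} (h : IsBranching ν a L Q)
    (hQ : ∀ a' x, a ⊆ a' → Consistent ν a' → Q a' x → Q' a' x) : IsBranching ν a L Q' where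
  exists_consistent := h.exists_consistent
  subset := h.subset
  proper := h.proper
  correct := fun b hb hc => hQ _ _ (h.subset b hb) hc (h.correct b hb hc)

theorem map {L : List (Assumps × β)} {Q : Assumps → β → Prop} {Q' : Assumps → γ → Prop}
    (h : IsBranching ν a L Q) (f : Assumps × β → γ)
    (hQ : ∀ a' x, a ⊆ a' → Consistent ν a' → Q a' x → Q' a' (f (a', x))) :
    IsBranching ν a (L.map fun b => (b.1, f b)) Q' where
  exists_consistent := fun hc => by
    obtain ⟨b, hb, hb'⟩ := h.exists_consistent hc
    exact ⟨_, List.mem_map_of_mem hb, hb'⟩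
  subset := by
    simp only [List.mem_map, forall_exists_index, and_imp, forall_apply_eq_imp_iff₂]
    exact h.subset
  proper := by
    simp only [List.mem_map, forall_exists_index, and_imp, forall_apply_eq_imp_iff₂]
    exact h.proper
  correct := by
    simp only [List.mem_map, forall_exists_index, and_imp, forall_apply_eq_imp_iff₂]
    exact fun b hb hc => hQ _ _ (h.subset b hb) hc (h.correct b hb hc)

theorem flatMap {L : List (Assumps × β)} {Q : Assumps → β → Prop} {Q' : Assumps → γ → Prop}
    {k : Assumps × β → List (Assumps × γ)} (h : IsBranching ν a L Q)
    (hk : ∀ b ∈ L, (Consistent ν b.1 → Q b.1 b.2) → IsBranching ν b.1 (k b) Q') :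
    IsBranching ν a (L.flatMap k) Q' where
  exists_consistent := fun hc => by
    obtain ⟨b, hb, hb'⟩ := h.exists_consistent hc
    obtain ⟨c, hc, hc'⟩ := (hk b hb (h.correct b hb)).exists_consistent hb'
    exact ⟨c, List.mem_flatMap.2 ⟨b, hb, hc⟩, hc'⟩
  subset := fun c hc => by
    obtain ⟨b, hb, hc⟩ := List.mem_flatMap.1 hc
    exact List.Subset.trans (h.subset b hb) ((hk b hb (h.correct b hb)).subset c hc)
  proper := fun c hc hp => by
    obtain ⟨b, hb, hc⟩ := List.mem_flatMap.1 hc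
    exact (hk b hb (h.correct b hb)).proper c hc (h.proper b hb hp)
  correct := fun c hc hcons => by
    obtain ⟨b, hb, hc⟩ := List.mem_flatMap.1 hc
    exact (hk b hb (h.correct b hb)).correct c hc hcons

/-- Both families refine the same assumptions independently, so a pair may be contradictory. Such a
pair holds at no valuation, and its data need not be correct; a true branch on each side gives a
true pair. -/
theorem flatMap₂ {δ : Type} {L : List (Assumps × β)} {R : List (Assumps × γ)}
    {Q : Assumps → β → Prop} {Q₂ : Assumps → γ → Prop} {Q' : Assumps → δ → Prop}
    {k : Assumps × β → Assumps × γ → List (Assumps × δ)} (h : IsBranching ν a L Q)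
    (h₂ : IsBranching ν a R Q₂)
    (hk : ∀ b ∈ L, ∀ c ∈ R, (Consistent ν (b.1 ++ c.1) → Q b.1 b.2 ∧ Q₂ c.1 c.2) →
      IsBranching ν (b.1 ++ c.1) (k b c) Q') :
    IsBranching ν a (L.flatMap fun b => R.flatMap fun c => k b c) Q' := by
  have hk' : ∀ b ∈ L, ∀ c ∈ R, IsBranching ν (b.1 ++ c.1) (k b c) Q' := fun b hb c hc =>
    hk b hb c hc fun hcons => ⟨h.correct b hb (hcons.mono (List.subset_append_left _ _)),
      h₂.correct c hc (hcons.mono (List.subset_append_right _ _))⟩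
  refine ⟨fun hc => ?_, fun d hd => ?_, fun d hd hp => ?_, fun d hd hcons => ?_⟩
  · obtain ⟨b, hb, hb'⟩ := h.exists_consistent hc
    obtain ⟨c, hc, hc'⟩ := h₂.exists_consistent hc
    obtain ⟨d, hd, hd'⟩ := (hk' b hb c hc).exists_consistent fun x hx =>
      (List.mem_append.1 hx).elim (hb' x) (hc' x)
    exact ⟨d, List.mem_flatMap.2 ⟨b, hb, List.mem_flatMap.2 ⟨c, hc, hd⟩⟩, hd'⟩
  all_goals
    obtain ⟨b, hb, hd⟩ := List.mem_flatMap.1 hd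
    obtain ⟨c, hc, hd⟩ := List.mem_flatMap.1 hd
  · exact List.Subset.trans (h.subset b hb)
      (List.Subset.trans (List.subset_append_left _ _) ((hk' b hb c hc).subset d hd))
  · exact (hk' b hb c hc).proper d hd fun x hx =>
      (List.mem_append.1 hx).elim (h.proper b hb hp x) (h₂.proper c hc hp x)
  · exact (hk' b hb c hc).correct d hd hcons

theorem trisect {L L₀ L₁ L₂ : List (Assumps × β)} {Q : Assumps → β → Prop} (c : RealMPoly)
    (hL : ∀ b, b ∈ L ↔ b ∈ L₀ ∨ b ∈ L₁ ∨ b ∈ L₂) (h₀ : IsBranching ν ((c, 0) :: a) L₀ Q)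
    (h₁ : IsBranching ν ((c, 1) :: a) L₁ Q) (h₂ : IsBranching ν ((c, -1) :: a) L₂ Q) :
    IsBranching ν a L Q where
  exists_consistent := fun hc => by
    have hcons : ∀ s, s = sgn (evalHom ν c) → Consistent ν ((c, s) :: a) := fun s hs x hx =>
      (List.mem_cons.1 hx).elim (fun e => by rw [e]; exact hs) (hc x)
    rcases sgn_cases (evalHom ν c) with ⟨_, e⟩ | ⟨_, e⟩ | ⟨_, e⟩
    · obtain ⟨b, hb, hb'⟩ := h₂.exists_consistent (hcons _ e.symm)
      exact ⟨b, (hL b).2 (Or.inr (Or.inr hb)), hb'⟩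
    · obtain ⟨b, hb, hb'⟩ := h₀.exists_consistent (hcons _ e.symm)
      exact ⟨b, (hL b).2 (Or.inl hb), hb'⟩
    · obtain ⟨b, hb, hb'⟩ := h₁.exists_consistent (hcons _ e.symm)
      exact ⟨b, (hL b).2 (Or.inr (Or.inl hb)), hb'⟩
  subset := fun b hb => by
    rcases (hL b).1 hb with hb | hb | hb
    · exact List.Subset.trans (List.subset_cons_self _ _) (h₀.subset b hb)
    · exact List.Subset.trans (List.subset_cons_self _ _) (h₁.subset b hb)
    · exact List.Subset.trans (List.subset_cons_self _ _) (h₂.subset b hb)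
  proper := fun b hb hp => by
    have hcons : ∀ s : ℚ, s = 0 ∨ s = 1 ∨ s = -1 → ProperSigns ((c, s) :: a) := fun s hs x hx =>
      (List.mem_cons.1 hx).elim (fun e => by rw [e]; exact hs) (hp x)
    rcases (hL b).1 hb with hb | hb | hb
    · exact h₀.proper b hb (hcons _ (by simp))
    · exact h₁.proper b hb (hcons _ (by simp))
    · exact h₂.proper b hb (hcons _ (by simp))
  correct := fun b hb => by
    rcases (hL b).1 hb with hb | hb | hb
    · exact h₀.correct b hb
    · exact h₁.correct b hb
    · exact h₂.correct b hb

end IsBranching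

/-! ### Tarski queries -/

theorem pseudoModAux_eq (q : RMPoly) : ∀ (k : ℕ) (r : RMPoly),
    ∃ d, pseudoModAux q k r = C (q.leadingCoeff ^ k) * r - d * q
  | 0, r => ⟨0, by simp [pseudoModAux]⟩
  | k + 1, r => by
    obtain ⟨d, hd⟩ := pseudoModAux_eq q k
      (C q.leadingCoeff * r - C (r.coeff (k + q.natDegree)) * X ^ k * q)
    refine ⟨d + C (q.leadingCoeff ^ k) * (C (r.coeff (k + q.natDegree)) * X ^ k), ?_⟩
    rw [pseudoModAux, hd, pow_succ, C_mul]
    ring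

/-- Pseudo-division multiplies `p` by a power of the leading coefficient of `q`. The extra factor in
`mulPseudoMod` makes the exponent even whenever it is odd, so the multiplier `c` is positive
whatever the sign of that coefficient. -/
theorem specialize_mulPseudoMod {ν : List ℝ} (p : RMPoly) {q : RMPoly}
    (hq : evalHom ν q.leadingCoeff ≠ 0) : ∃ (d : ℝ[X]) (c : ℝ), 0 < c ∧
      specialize ν (mulPseudoMod p q) = d * specialize ν q - C c * specialize ν p := by
  obtain ⟨d, hd⟩ := pseudoModAux_eq q (p.natDegree + 1 - q.natDegree) p
  unfold mulPseudoMod pseudoMod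
  rw [hd]
  split_ifs with he
  · refine ⟨specialize ν d, evalHom ν q.leadingCoeff ^ (p.natDegree + 1 - q.natDegree),
      he.pow_pos hq, ?_⟩
    simp only [map_mul, map_sub, map_pow, map_neg, map_one, specialize_C]
    ring
  · refine ⟨C (evalHom ν q.leadingCoeff) * specialize ν d,
      evalHom ν q.leadingCoeff ^ (p.natDegree + 1 - q.natDegree + 1),
      (Nat.even_add_one.2 he).pow_pos hq, ?_⟩
    simp only [map_mul, map_sub, map_pow, map_neg, specialize_C]
    ring

/-- Writing the indicator of opposite signs as `(1 - x * y) / 2` puts the count in the form of the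
boundary term of `cauchyIndex_step`. -/
theorem signChanges_cons_cons {x y : ℚ} (hx : x ^ 2 = 1) (hy : y ^ 2 = 1) (l : List ℚ) :
    (signChanges (x :: y :: l) : ℚ) = (1 - x * y) / 2 + signChanges (y :: l) := by
  have hx0 : x ≠ 0 := by rintro rfl; norm_num at hx
  have hy0 : y ≠ 0 := by rintro rfl; norm_num at hy
  have hs : signChanges (x :: y :: l) =
      (if x * y < 0 then 1 else 0) + signChanges (y :: l) := by
    simp [signChanges, adjacentChanges, hx0, hy0]
  rw [hs]
  rcases sq_eq_sq_iff_eq_or_eq_neg.1 (hx.trans (one_pow 2).symm) with rfl | rfl <;>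
    rcases sq_eq_sq_iff_eq_or_eq_neg.1 (hy.trans (one_pow 2).symm) with rfl | rfl <;> norm_num

theorem tarskiOfSeq_singleton (a : Assumps) (p : RMPoly) : tarskiOfSeq a [p] = 0 := by
  have h : ∀ x : ℚ, signChanges [x] = 0 := fun x => by
    by_cases hx : x = 0 <;> simp [signChanges, adjacentChanges, hx]
  simp [tarskiOfSeq, h]

theorem tarskiOfSeq_cons_cons {ν : List ℝ} {a : Assumps} (ha : Consistent ν a) {p q : RMPoly}
    (hp : LeadAssumedNonzero a p) (hq : LeadAssumedNonzero a q) (ps : List RMPoly) :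
    tarskiOfSeq a (p :: q :: ps) = tarskiOfSeq a (q :: ps) +
      (sgn (specialize ν p).leadingCoeff * sgn (specialize ν q).leadingCoeff -
        (-1) ^ (specialize ν p).natDegree * sgn (specialize ν p).leadingCoeff *
        ((-1) ^ (specialize ν q).natDegree * sgn (specialize ν q).leadingCoeff)) / 2 := by
  have hp0 := hp.eval_ne_zero ha
  have hq0 := hq.eval_ne_zero ha
  have hsq : ∀ (n : ℕ) (x : ℚ), x ^ 2 = 1 → ((-1) ^ n * x) ^ 2 = 1 := fun n x hx => by
    rw [mul_pow, hx, ← pow_mul, mul_comm n 2, pow_mul]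
    simp
  rw [leadingCoeff_specialize hp0, leadingCoeff_specialize hq0, natDegree_specialize hp0,
    natDegree_specialize hq0]
  simp only [tarskiOfSeq, List.map_cons, hp.lookupSign_eq ha, hq.lookupSign_eq ha, Option.getD_some]
  rw [signChanges_cons_cons (hsq _ _ (sgn_sq_of_ne_zero hp0)) (hsq _ _ (sgn_sq_of_ne_zero hq0)),
    signChanges_cons_cons (sgn_sq_of_ne_zero hp0) (sgn_sq_of_ne_zero hq0)]
  ring

/-- Each division step changes both sides by the same boundary term, and dropping a vanishing
leading term leaves the specialization unchanged. The head of the sequence is part of the invariant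
because `tarskiOfSeq_cons_cons` must see the first two members when a polynomial is prepended. -/
theorem isBranching_spmodsAux (ν : List ℝ) (p q : RMPoly) (a : Assumps) :
    LeadAssumedNonzero a p → IsBranching ν a (spmodsAux p q a) fun a' ps =>
      (∃ t, ps = p :: t) ∧ tarskiOfSeq a' ps = cauchyIndex (specialize ν q) (specialize ν p) := by
  have step : ∀ (p q : RMPoly) (a : Assumps), LeadAssumedNonzero a p → LeadAssumedNonzero a q →
      IsBranching ν a (spmodsAux q (mulPseudoMod p q) a) (fun a' ps => (∃ t, ps = q :: t) ∧
        tarskiOfSeq a' ps =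
          cauchyIndex (specialize ν (mulPseudoMod p q)) (specialize ν q)) →
      IsBranching ν a ((spmodsAux q (mulPseudoMod p q) a).map fun b => (b.1, p :: b.2))
        fun a' ps => (∃ t, ps = p :: t) ∧
          tarskiOfSeq a' ps = cauchyIndex (specialize ν q) (specialize ν p) := by
    intro p q a hp hq h
    refine h.map (fun b => p :: b.2) ?_
    rintro a' _ haa' hcons ⟨⟨t, rfl⟩, ht⟩
    have hp' := hp.mono haa'
    have hq' := hq.mono haa'
    obtain ⟨d, c, hc, hd⟩ := specialize_mulPseudoMod (ν := ν) p (hq'.eval_ne_zero hcons)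
    refine ⟨⟨_, rfl⟩, ?_⟩
    rw [tarskiOfSeq_cons_cons hcons hp' hq', ht, hd,
      ← cauchyIndex_step (specialize_ne_zero (hp'.eval_ne_zero hcons))
        (specialize_ne_zero (hq'.eval_ne_zero hcons)) d hc]
  induction p, q, a using spmodsAux.induct with
  | case1 p a =>
    intro _
    rw [spmodsAux, dif_pos rfl]
    exact .pure fun _ => ⟨⟨_, rfl⟩, by simp [tarskiOfSeq_singleton]⟩
  | case2 p q a hq hl ih₀ ih₁ ih₂ =>
    intro hp
    rw [spmodsAux, dif_neg hq, hl]
    refine .trisect (L₀ := spmodsAux p q.eraseLead ((q.leadingCoeff, 0) :: a))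
      q.leadingCoeff (fun b => by simp only [List.mem_append, or_assoc]) ?_
      (step p q _ (hp.mono (List.subset_cons_self _ _)) ⟨1, one_ne_zero, by simp⟩
        (ih₁ ⟨1, one_ne_zero, by simp⟩))
      (step p q _ (hp.mono (List.subset_cons_self _ _)) ⟨-1, by norm_num, by simp⟩
        (ih₂ ⟨-1, by norm_num, by simp⟩))
    refine (ih₀ (hp.mono (List.subset_cons_self _ _))).imp fun a' ps haa' hcons h => ?_
    have h0 := hcons (q.leadingCoeff, 0) (haa' (by simp))
    rwa [specialize_eraseLead (sgn_eq_zero_iff.1 h0.symm)] at h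
  | case3 p q a hq hl ih =>
    intro hp
    rw [spmodsAux, dif_neg hq, hl]
    simp only [if_true]
    refine (ih hp).imp fun a' ps haa' hcons h => ?_
    have h0 := hcons (q.leadingCoeff, 0) (haa' (mem_of_lookupSign hl))
    rwa [specialize_eraseLead (sgn_eq_zero_iff.1 h0.symm)] at h
  | case4 p q a hq s hl hs ih =>
    intro hp
    rw [spmodsAux, dif_neg hq, hl]
    simp only [if_neg hs]
    have hq' : LeadAssumedNonzero a q := ⟨s, hs, mem_of_lookupSign hl⟩
    exact step p q a hp hq' (ih hq')

theorem isBranching_spmods (ν : List ℝ) (p q : RMPoly) (a : Assumps) :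
    IsBranching ν a (spmods p q a) fun a' ps =>
      tarskiOfSeq a' ps = cauchyIndex (specialize ν q) (specialize ν p) := by
  induction p, a using spmods.induct with
  | case1 a =>
    rw [spmods, dif_pos rfl]
    exact .pure fun _ => by simp [cauchyIndex, tarskiOfSeq, signChanges, adjacentChanges]
  | case2 p a hp hl ih =>
    rw [spmods, dif_neg hp, hl]
    refine .trisect (L₀ := spmods p.eraseLead q ((p.leadingCoeff, 0) :: a))
      p.leadingCoeff (fun b => by simp only [List.mem_append, or_assoc]) ?_
      ((isBranching_spmodsAux ν p q _ ⟨1, one_ne_zero, by simp⟩).imp fun _ _ _ _ h => h.2)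
      ((isBranching_spmodsAux ν p q _ ⟨-1, by norm_num, by simp⟩).imp fun _ _ _ _ h => h.2)
    refine ih.imp fun a' ps haa' hcons h => ?_
    have h0 := hcons (p.leadingCoeff, 0) (haa' (by simp))
    rwa [specialize_eraseLead (sgn_eq_zero_iff.1 h0.symm)] at h
  | case3 p a hp hl ih =>
    rw [spmods, dif_neg hp, hl]
    simp only [if_true]
    refine ih.imp fun a' ps haa' hcons h => ?_
    have h0 := hcons (p.leadingCoeff, 0) (haa' (mem_of_lookupSign hl))
    rwa [specialize_eraseLead (sgn_eq_zero_iff.1 h0.symm)] at h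
  | case4 p a hp s hl hs =>
    rw [spmods, dif_neg hp, hl]
    simp only [if_neg hs]
    exact (isBranching_spmodsAux ν p q _ ⟨s, hs, mem_of_lookupSign hl⟩).imp fun _ _ _ _ h => h.2

theorem prod_one_sub_sgn_sq (I : List ℝ) :
    (I.map fun y => 1 - sgn y ^ 2).prod =
      (open scoped Classical in if ∀ y ∈ I, y = 0 then 1 else 0) := by
  classical
  induction I with
  | nil => simp
  | cons y I ih =>
    rw [List.map_cons, List.prod_cons, ih, one_sub_sgn_sq]
    by_cases hy : y = 0 <;> simp [hy]

theorem sum_sq_eq_zero_iff (I : List ℝ) : (I.map fun y => y ^ 2).sum = 0 ↔ ∀ y ∈ I, y = 0 := by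
  induction I with
  | nil => simp
  | cons y I ih =>
    have h : 0 ≤ (I.map fun y => y ^ 2).sum := List.sum_nonneg (by
      simp only [List.mem_map, forall_exists_index, and_imp, forall_apply_eq_imp_iff₂]
      exact fun x _ => sq_nonneg x)
    rw [List.map_cons, List.sum_cons, add_eq_zero_iff_of_nonneg (sq_nonneg y) h, ih]
    simp

/-- The Tarski query of `p ^ 2 + ∑ q_i ^ 2` and `∏ q_j` as a sum over the roots of `p`. -/
theorem cauchyIndex_sum_sq (p : ℝ[X]) (I J : List ℝ[X])
    (hI : p = 0 → ∀ q ∈ I, q.natDegree = 0) :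
    cauchyIndex (derivative (p ^ 2 + (I.map fun q => q ^ 2).sum) * J.prod)
        (p ^ 2 + (I.map fun q => q ^ 2).sum) =
      ∑ x ∈ p.roots.toFinset, (I.map fun q => 1 - sgn (q.eval x) ^ 2).prod *
        (J.map fun q => sgn (q.eval x)).prod := by
  classical
  set g := p ^ 2 + (I.map fun q => q ^ 2).sum with hg
  -- For `p = 0` the right side is an empty sum, as `roots 0` is empty. On the left, `hI` makes `g`
  -- constant, so `derivative g` is zero.
  rcases eq_or_ne p 0 with rfl | hp
  · have hc : ∀ I : List ℝ[X], (∀ q ∈ I, q.natDegree = 0) →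
        derivative (I.map fun q => q ^ 2).sum = 0 := by
      intro I
      induction I with
      | nil => simp
      | cons q I ih =>
        intro h
        rw [List.map_cons, List.sum_cons, derivative_add, ih fun r hr => h r (by simp [hr]),
          eq_C_of_natDegree_eq_zero (h q (by simp)), ← C_pow, derivative_C, add_zero]
    have : derivative g = 0 := by
      rw [hg, derivative_add, hc I (hI rfl)]
      simp
    simp [this]
  have heval : ∀ x, g.eval x = p.eval x ^ 2 + ((I.map fun q => q.eval x).map fun y => y ^ 2).sum := by
    intro x
    rw [hg, eval_add, eval_pow, ← coe_evalRingHom, map_list_sum, List.map_map, List.map_map]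
    simp [Function.comp_def]
  have hroot : ∀ x, g.eval x = 0 ↔ p.eval x = 0 ∧ ∀ y ∈ I.map fun q => q.eval x, y = 0 := by
    intro x
    rw [heval, add_eq_zero_iff_of_nonneg (sq_nonneg _), sum_sq_eq_zero_iff]
    · simp
    · exact List.sum_nonneg (by
        simp only [List.mem_map, forall_exists_index, and_imp, forall_apply_eq_imp_iff₂]
        exact fun x _ => sq_nonneg _)
  have hg0 : g ≠ 0 := by
    intro h0
    refine hp (Polynomial.funext fun x => ?_)
    rw [eval_zero]
    exact ((hroot x).1 (by rw [h0, eval_zero])).1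
  have hset : g.roots.toFinset =
      p.roots.toFinset.filter fun x => ∀ y ∈ I.map fun q => q.eval x, y = 0 := by
    ext x
    simp only [Multiset.mem_toFinset, mem_roots hg0, Finset.mem_filter, mem_roots hp, IsRoot, hroot]
  rw [cauchyIndex_derivative_mul hg0, hset, Finset.sum_filter]
  refine Finset.sum_congr rfl fun x _ => ?_
  have h1 := prod_one_sub_sgn_sq (I.map fun q => q.eval x)
  rw [List.map_map] at h1
  simp only [Function.comp_def] at h1
  rw [h1, ← coe_evalRingHom, map_list_prod, map_list_prod, List.map_map]
  split_ifs <;> simp [Function.comp_def]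

theorem isBranching_tarskiQueries (ν : List ℝ) (p : RMPoly) (a : Assumps) (I J : List RMPoly)
    (hI : Consistent ν a → specialize ν p = 0 → ∀ q ∈ I, (specialize ν q).natDegree = 0) :
    IsBranching ν a (tarskiQueries p a I J) fun _ N => N =
      ∑ x ∈ (specialize ν p).roots.toFinset,
        (I.map fun q => 1 - sgn ((specialize ν q).eval x) ^ 2).prod *
        (J.map fun q => sgn ((specialize ν q).eval x)).prod := by
  refine (isBranching_spmods ν _ _ a).map (fun b => tarskiOfSeq b.1 b.2) ?_
  rintro a' ps haa' hcons h
  have key := cauchyIndex_sum_sq (specialize ν p) (I.map (specialize ν)) (J.map (specialize ν))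
    (by simpa using hI (hcons.mono haa'))
  have hsum : specialize ν (p ^ 2 + (I.map fun q => q ^ 2).sum) =
      specialize ν p ^ 2 + ((I.map (specialize ν)).map fun q => q ^ 2).sum := by
    rw [map_add, map_pow, map_list_sum, List.map_map, List.map_map]
    simp [Function.comp_def]
  have hder : ∀ f : RMPoly, specialize ν (derivative f) = derivative (specialize ν f) :=
    fun f => (derivative_map f _).symm
  rw [h, map_mul, hder, hsum, map_list_prod, key]
  simp only [List.map_map, Function.comp_def]

/-! ### Greedy selection of independent vectors -/

section Greedy

variable {V : Type*} [AddCommGroup V] [Module ℚ V] {m : ℕ} (v : Fin m → V)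

/-- The indices of the vectors that are not linear combinations of earlier ones. -/
def greedyBasis : Set (Fin m) := {i | v i ∉ Submodule.span ℚ (v '' {k | k < i})}

/-- Strong induction on the index: a rejected vector is a combination of earlier ones, which already
lie in the span. -/
theorem mem_span_greedyBasis (i : Fin m) : v i ∈ Submodule.span ℚ (v '' greedyBasis v) := by
  induction i using WellFoundedLT.induction with
  | ind i ih =>
    by_cases hi : i ∈ greedyBasis v
    · exact Submodule.subset_span ⟨i, hi, rfl⟩
    · refine Submodule.span_le.2 ?_ (not_not.1 hi)
      rintro _ ⟨k, hk, rfl⟩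
      exact ih k hk

theorem linearIndepOn_greedyBasis : LinearIndepOn ℚ v (greedyBasis v) := by
  have key : ∀ j : ℕ, LinearIndepOn ℚ v {k | k ∈ greedyBasis v ∧ k.val < j} := by
    intro j
    induction j with
    | zero => simp
    | succ j ih =>
      by_cases hj : ∃ i ∈ greedyBasis v, i.val = j
      · obtain ⟨i, hi, rfl⟩ := hj
        have h : v i ∉ Submodule.span ℚ (v '' {k | k ∈ greedyBasis v ∧ k.val < i.val}) := by
          intro hmem
          exact hi (Submodule.span_mono (Set.image_mono fun k hk => hk.2) hmem)
        refine (ih.insert h).mono ?_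
        rintro k ⟨hk, hlt⟩
        rcases Nat.lt_succ_iff_lt_or_eq.1 hlt with h' | h'
        · exact Or.inr ⟨hk, h'⟩
        · exact Or.inl (Fin.ext h')
      · refine ih.mono ?_
        rintro k ⟨hk, hlt⟩
        refine ⟨hk, lt_of_le_of_ne (Nat.lt_succ_iff.1 hlt) fun h' => hj ⟨k, hk, h'⟩⟩
  exact (key m).mono fun k hk => ⟨hk, k.isLt⟩

theorem card_greedyBasis [Fintype (greedyBasis v)] :
    Fintype.card (greedyBasis v) = Module.finrank ℚ (Submodule.span ℚ (Set.range v)) := by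
  have hspan : Submodule.span ℚ (Set.range v) =
      Submodule.span ℚ (Set.range fun k : greedyBasis v => v k) := by
    rw [← Set.image_eq_range]
    refine le_antisymm (Submodule.span_le.2 ?_) (Submodule.span_mono (Set.image_subset_range _ _))
    rintro _ ⟨i, rfl⟩
    exact mem_span_greedyBasis v i
  rw [hspan, finrank_span_eq_card (linearIndepOn_greedyBasis v)]

end Greedy

/-! ### Reduction of matrix equations -/

/-- The entry of the sign matrix for the row `s` and the column `t`. -/
def rowValue (s : List ℕ × List ℕ) (t : List ℚ) : ℚ :=
  (s.1.map fun l => 1 - t.getD l 0 ^ 2).prod * (s.2.map fun l => t.getD l 0).prod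

theorem sum_map_eq_sum_get {ι : Type*} (l : List ι) (f : ι → ℚ) :
    (l.map f).sum = ∑ j, f (l.get j) :=
  (Fin.sum_univ_fun_getElem l f).symm

/-- The columns of the sign matrix are linearly independent. -/
def ColumnsIndependent (S : List (List ℕ × List ℕ)) (T : List (List ℚ)) : Prop :=
  ∀ w : List ℚ → ℚ, (∀ s ∈ S, (T.map fun t => rowValue s t * w t).sum = 0) → ∀ t ∈ T, w t = 0

/-- A matrix equation for `n` polynomials with an invertible matrix. -/
structure MatrixEq.Valid (n : ℕ) (E : MatrixEq) : Prop where
  nodup : E.signs.Nodup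
  length_signs : ∀ t ∈ E.signs, t.length = n
  index_lt : ∀ s ∈ E.subsets, (∀ l ∈ s.1, l < n) ∧ ∀ l ∈ s.2, l < n
  length_eq : E.signs.length = E.subsets.length
  independent : ColumnsIndependent E.subsets E.signs

theorem signMatrix_mulVec_injective {S : List (List ℕ × List ℕ)} {T : List (List ℚ)}
    (hT : T.Nodup) (h : ColumnsIndependent S T) : Function.Injective (signMatrix S T).mulVec := by
  change Function.Injective (signMatrix S T).mulVecLin
  rw [injective_iff_map_eq_zero]
  intro u hu
  have hget : Function.Injective T.get := List.nodup_iff_injective_get.1 hT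
  -- `ColumnsIndependent` uses weights on sign lists, not on positions; since `T` has no duplicates,
  -- a vector indexed by positions transfers.
  have key := h (Function.extend T.get u 0) fun s hs => by
    obtain ⟨i, rfl⟩ := List.get_of_mem hs
    rw [sum_map_eq_sum_get]
    simp only [hget.extend_apply]
    exact congrFun hu i
  funext j
  have hj := key (T.get j) (T.get_mem j)
  rwa [hget.extend_apply] at hj

open scoped Classical in
/-- The rows of the sign matrix that are not linear combinations of earlier rows. -/
def keptRows (S : List (List ℕ × List ℕ)) (T : List (List ℚ)) : List (List ℕ × List ℕ) :=
  ((List.finRange S.length).filter fun i => (signMatrix S T).row i ∉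
    Submodule.span ℚ ((signMatrix S T).row '' {k | k < i})).map S.get

theorem keptRows_subset (S : List (List ℕ × List ℕ)) (T : List (List ℚ)) : keptRows S T ⊆ S := by
  intro s hs
  obtain ⟨i, -, rfl⟩ := List.mem_map.1 hs
  exact S.get_mem i

/-- The kept rows form a basis of the row space, so their number is the rank, which is the number of
columns because these are independent. -/
theorem length_keptRows {S : List (List ℕ × List ℕ)} {T : List (List ℚ)}
    (hT : T.Nodup) (h : ColumnsIndependent S T) : (keptRows S T).length = T.length := by
  classical
  have h1 : (keptRows S T).length = Fintype.card (greedyBasis (signMatrix S T).row) := by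
    have hnd : ((List.finRange S.length).filter
        fun i => (signMatrix S T).row i ∉
          Submodule.span ℚ ((signMatrix S T).row '' {k | k < i})).Nodup := (List.nodup_finRange _).filter _
    rw [keptRows, List.length_map, ← List.toFinset_card_of_nodup hnd, Fintype.card_subtype]
    congr 1
    ext i
    simp only [List.mem_toFinset, List.mem_filter, List.mem_finRange, true_and,
      decide_eq_true_eq, Finset.mem_filter, Finset.mem_univ]
    rfl
  rw [h1, card_greedyBasis, ← Matrix.rank_eq_finrank_span_row, Matrix.rank,
    LinearMap.finrank_range_of_inj (signMatrix_mulVec_injective hT h)]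
  simp

/-- A relation between the columns is a linear functional on the rows. If it kills the kept rows, it
kills their span, which contains every row. -/
theorem columnsIndependent_keptRows {S : List (List ℕ × List ℕ)} {T : List (List ℚ)}
    (h : ColumnsIndependent S T) : ColumnsIndependent (keptRows S T) T := by
  intro w hw
  refine h w fun s hs => ?_
  obtain ⟨i, rfl⟩ := List.get_of_mem hs
  set φ : (Fin T.length → ℚ) →ₗ[ℚ] ℚ := ∑ j, w (T.get j) • LinearMap.proj j with hφ
  have hφ' : ∀ k, φ ((signMatrix S T).row k) =
      (T.map fun t => rowValue (S.get k) t * w t).sum := by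
    intro k
    rw [sum_map_eq_sum_get, hφ, LinearMap.sum_apply]
    refine Finset.sum_congr rfl fun j _ => ?_
    rw [LinearMap.smul_apply, LinearMap.proj_apply, smul_eq_mul, mul_comm]
    rfl
  have hle : Submodule.span ℚ ((signMatrix S T).row '' greedyBasis (signMatrix S T).row) ≤
      LinearMap.ker φ := by
    rw [Submodule.span_le]
    rintro _ ⟨k, hk, rfl⟩
    rw [SetLike.mem_coe, LinearMap.mem_ker, hφ']
    exact hw _ (List.mem_map.2 ⟨k, by simpa [greedyBasis] using hk, rfl⟩)
  rw [← hφ']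
  exact hle (mem_span_greedyBasis _ i)

theorem columnsIndependent_filter {S : List (List ℕ × List ℕ)} {T : List (List ℚ)}
    (h : ColumnsIndependent S T) (P : List ℚ → Prop) [DecidablePred P] :
    ColumnsIndependent S (T.filter P) := by
  intro w hw t ht
  obtain ⟨htT, hP⟩ := List.mem_filter.1 ht
  have hsum : ∀ (f : List ℚ → ℚ) (T : List (List ℚ)),
      (T.map fun t => f t * if P t then w t else 0).sum =
        ((T.filter P).map fun t => f t * w t).sum := by
    intro f T
    induction T with
    | nil => rfl
    | cons t T ih =>
      rw [List.map_cons, List.sum_cons, ih]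
      by_cases ht : P t <;> simp [ht]
  have := h (fun t => if P t then w t else 0) (fun s hs => by
    rw [hsum]
    exact hw s hs) t htT
  rwa [if_pos (by simpa using hP)] at this

theorem filter_finRange_map_get {ι : Type*} (l : List ι) (P : ι → Prop) [DecidablePred P] :
    ((List.finRange l.length).filter fun j => P (l.get j)).map l.get = l.filter P := by
  conv_rhs => rw [← List.map_get_finRange l, List.filter_map]
  rfl

-- Double counting: grouping the points of `Z` by their sign vector shows that the vector of counts
-- satisfies `M w = v`, and `M` is invertible. Coverage `hZ` ensures that no point is lost in the
-- grouping.
open scoped Classical in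
theorem MatrixEq.Valid.solve_eq {n : ℕ} {E : MatrixEq} (hE : E.Valid n) (Z : Finset ℝ)
    (sv : ℝ → List ℚ) (hZ : ∀ x ∈ Z, sv x ∈ E.signs) (j : Fin E.signs.length) :
    E.solve (E.subsets.map fun s => ∑ x ∈ Z, rowValue s (sv x)) j =
      ((Z.filter fun x => sv x = E.signs.get j).card : ℚ) := by
  have hget : Function.Injective E.signs.get := List.nodup_iff_injective_get.1 hE.nodup
  set w : Fin E.signs.length → ℚ := fun j => ((Z.filter fun x => sv x = E.signs.get j).card : ℚ)
    with hw
  set M := (signMatrix E.subsets E.signs).submatrix (Fin.cast hE.length_eq) id with hM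
  have hinj : Function.Injective M.mulVec := by
    intro u u' huu
    refine signMatrix_mulVec_injective hE.nodup hE.independent (funext fun i => ?_)
    exact congrFun huu (Fin.cast hE.length_eq.symm i)
  have hunit : IsUnit M.det := (Matrix.isUnit_iff_isUnit_det M).1
    (Matrix.mulVec_injective_iff_isUnit.1 hinj)
  have hmul : M.mulVec w = fun i : Fin E.signs.length =>
      (E.subsets.map fun s => ∑ x ∈ Z, rowValue s (sv x)).getD i.val 0 := by
    funext i
    have hi : i.val < E.subsets.length := hE.length_eq ▸ i.isLt
    rw [List.getD_eq_getElem _ _ (by simpa using hi), List.getElem_map]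
    have h1 : ∀ x ∈ Z, rowValue E.subsets[i.val] (sv x) =
        ∑ j, if sv x = E.signs.get j then rowValue E.subsets[i.val] (E.signs.get j) else 0 := by
      intro x hx
      obtain ⟨j, hj⟩ := List.get_of_mem (hZ x hx)
      rw [← hj]
      simp only [hget.eq_iff]
      simp
    rw [Finset.sum_congr rfl h1, Finset.sum_comm]
    change ∑ j, M i j * w j = _
    refine Finset.sum_congr rfl fun j _ => ?_
    rw [← Finset.sum_filter, Finset.sum_const, nsmul_eq_mul, mul_comm]
    rfl
  unfold MatrixEq.solve
  rw [dif_pos hE.length_eq]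
  change (M⁻¹.mulVec _) j = w j
  rw [← hmul, Matrix.mulVec_mulVec, Matrix.nonsing_inv_mul M hunit, Matrix.one_mulVec]

theorem MatrixEq.Valid.reduce_solve {n : ℕ} {E : MatrixEq} (hE : E.Valid n) (Z : Finset ℝ)
    (sv : ℝ → List ℚ) (hZ : ∀ x ∈ Z, sv x ∈ E.signs) :
    (E.reduce (E.solve (E.subsets.map fun s => ∑ x ∈ Z, rowValue s (sv x)))).Valid n ∧
      ∀ t, t ∈ (E.reduce (E.solve (E.subsets.map fun s => ∑ x ∈ Z, rowValue s (sv x)))).signs ↔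
        ∃ x ∈ Z, sv x = t := by
  classical
  set w := E.solve (E.subsets.map fun s => ∑ x ∈ Z, rowValue s (sv x)) with hw
  have hred : E.reduce w = ⟨keptRows E.subsets (E.reduce w).signs, (E.reduce w).signs⟩ := rfl
  have hsigns : (E.reduce w).signs = E.signs.filter fun t => ∃ x ∈ Z, sv x = t := by
    rw [← filter_finRange_map_get]
    unfold MatrixEq.reduce
    simp only
    congr 1
    refine List.filter_congr fun j _ => ?_
    rw [hw, hE.solve_eq Z sv hZ, decide_eq_decide, Nat.cast_ne_zero, Finset.card_ne_zero,
      Finset.filter_nonempty_iff]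
  have hind := columnsIndependent_filter hE.independent fun t => ∃ x ∈ Z, sv x = t
  have hnd : (E.signs.filter fun t => ∃ x ∈ Z, sv x = t).Nodup := hE.nodup.filter _
  rw [hred, hsigns]
  refine ⟨⟨hnd, fun t ht => hE.length_signs t (List.mem_of_mem_filter ht),
    fun s hs => hE.index_lt s (keptRows_subset _ _ hs), (length_keptRows hnd hind).symm,
    columnsIndependent_keptRows hind⟩, fun t => ?_⟩
  simp only [List.mem_filter, decide_eq_true_eq, and_iff_right_iff_imp]
  rintro ⟨x, hx, rfl⟩
  exact hZ x hx

/-! ### Base cases and combination -/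

theorem emptyCase_valid : emptyCase.Valid 0 where
  nodup := by simp [emptyCase]
  length_signs := by simp [emptyCase]
  index_lt := by simp [emptyCase]
  length_eq := rfl
  independent := by
    intro w hw
    simpa [emptyCase, rowValue] using hw

theorem baseCase_valid : baseCase.Valid 1 where
  nodup := by simp [baseCase]; norm_num
  length_signs := by simp [baseCase]
  index_lt := by simp [baseCase]
  length_eq := rfl
  independent := by
    intro w hw
    simp only [baseCase, List.forall_mem_cons, rowValue, List.map_cons, List.map_nil, List.sum_cons,
      List.sum_nil, List.prod_nil, List.prod_cons, List.getD_cons_zero] at hw ⊢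
    obtain ⟨h1, h2, h3, -⟩ := hw
    norm_num at h1 h2 h3
    refine ⟨by linarith, by linarith, by linarith, by simp⟩

theorem rowValue_append {n : ℕ} {s t : List ℕ × List ℕ} {σ τ : List ℚ} (hσ : σ.length = n)
    (hs : (∀ l ∈ s.1, l < n) ∧ ∀ l ∈ s.2, l < n) :
    rowValue (s.1 ++ t.1.map (fun l => l + n), s.2 ++ t.2.map (fun l => l + n)) (σ ++ τ) =
      rowValue s σ * rowValue t τ := by
  have hr : ∀ l, (σ ++ τ).getD (l + n) 0 = τ.getD l 0 := fun l => by
    rw [List.getD_append_right _ _ _ _ (by omega)]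
    congr 1
    omega
  have hl : ∀ l, l < n → (σ ++ τ).getD l 0 = σ.getD l 0 := fun l h =>
    List.getD_append _ _ _ _ (by omega)
  have h1 : s.1.map (fun l => 1 - (σ ++ τ).getD l 0 ^ 2) = s.1.map fun l => 1 - σ.getD l 0 ^ 2 :=
    List.map_congr_left fun l h => by rw [hl l (hs.1 l h)]
  have h2 : s.2.map (fun l => (σ ++ τ).getD l 0) = s.2.map fun l => σ.getD l 0 :=
    List.map_congr_left fun l h => hl l (hs.2 l h)
  simp only [rowValue, List.map_append, List.prod_append, List.map_map, Function.comp_def, hr, h1,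
    h2]
  ring

/-- Entries multiply by `rowValue_append`, so a relation between the combined columns can be
cancelled one factor at a time: first through `E₁` with a row `t` of `E₂` fixed, then through `E₂`.
Equal lengths of the first parts make the concatenated sign lists distinct. -/
theorem MatrixEq.Valid.combine {n k : ℕ} {E₁ E₂ : MatrixEq} (h₁ : E₁.Valid n) (h₂ : E₂.Valid k) :
    (combine n E₁ E₂).Valid (n + k) where
  nodup := by
    refine List.nodup_flatMap.2 ⟨fun s _ => h₂.nodup.map (List.append_right_injective s), ?_⟩
    refine h₁.nodup.imp_of_mem fun {s s'} hs hs' hne => ?_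
    intro x hx hx'
    obtain ⟨t, -, rfl⟩ := List.mem_map.1 hx
    obtain ⟨t', -, he⟩ := List.mem_map.1 hx'
    exact hne (List.append_inj he ((h₁.length_signs s' hs').trans
      (h₁.length_signs s hs).symm)).1.symm
  length_signs := by
    intro x hx
    obtain ⟨s, hs, hx⟩ := List.mem_flatMap.1 hx
    obtain ⟨t, ht, rfl⟩ := List.mem_map.1 hx
    rw [List.length_append, h₁.length_signs s hs, h₂.length_signs t ht]
  index_lt := by
    intro x hx
    obtain ⟨s, hs, hx⟩ := List.mem_flatMap.1 hx
    obtain ⟨t, ht, rfl⟩ := List.mem_map.1 hx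
    have hs' := h₁.index_lt s hs
    have ht' := h₂.index_lt t ht
    constructor <;> intro l hl <;> rcases List.mem_append.1 hl with hl | hl
    · have := hs'.1 l hl; omega
    · obtain ⟨l', hl', rfl⟩ := List.mem_map.1 hl
      have := ht'.1 l' hl'; omega
    · have := hs'.2 l hl; omega
    · obtain ⟨l', hl', rfl⟩ := List.mem_map.1 hl
      have := ht'.2 l' hl'; omega
  length_eq := by
    simp [HybridQE.combine, List.length_flatMap, h₁.length_eq, h₂.length_eq]
  independent := by
    intro w hw x hx
    obtain ⟨s₀, hs₀, hx⟩ := List.mem_flatMap.1 hx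
    obtain ⟨t₀, ht₀, rfl⟩ := List.mem_map.1 hx
    refine h₂.independent (fun τ => w (s₀ ++ τ)) (fun t ht => ?_) t₀ ht₀
    refine h₁.independent
      (fun σ => (E₂.signs.map fun τ => rowValue t τ * w (σ ++ τ)).sum) (fun s hs => ?_) s₀ hs₀
    have h := hw _ (List.mem_flatMap.2 ⟨s, hs, List.mem_map.2 ⟨t, ht, rfl⟩⟩)
    rw [← h]
    simp only [HybridQE.combine]
    rw [List.map_flatMap, List.flatMap_def, List.sum_flatten, List.map_map]
    congr 1
    refine List.map_congr_left fun σ hσ => ?_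
    rw [Function.comp_apply, List.map_map, ← List.sum_map_mul_left]
    congr 1
    refine List.map_congr_left fun τ _ => ?_
    simp only [Function.comp_apply]
    rw [rowValue_append (h₁.length_signs σ hσ) (h₁.index_lt s hs), mul_assoc]

/-! ### Correctness of the matrix equations -/

/-- The signs of the polynomials `qs`, with coefficients specialized at `ν`, at the point `x`. -/
def signVector (ν : List ℝ) (qs : List RMPoly) (x : ℝ) : List ℚ :=
  qs.map fun q => sgn ((specialize ν q).eval x)

theorem signVector_getD (ν : List ℝ) (qs : List RMPoly) (x : ℝ) (l : ℕ) :
    (signVector ν qs x).getD l 0 = sgn ((specialize ν (qs.getD l 0)).eval x) := by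
  rcases lt_or_ge l qs.length with h | h
  · rw [List.getD_eq_getElem _ _ (by simpa [signVector] using h), List.getD_eq_getElem _ _ h]
    simp [signVector]
  · rw [List.getD_eq_default _ _ (by simpa [signVector] using h), List.getD_eq_default _ _ h]
    simp

theorem isBranching_rhsVectors (ν : List ℝ) (p : RMPoly) (qs : List RMPoly)
    (S : List (List ℕ × List ℕ)) : ∀ a : Assumps, (Consistent ν a → specialize ν p = 0 →
      ∀ q ∈ qs, (specialize ν q).natDegree = 0) →
    IsBranching ν a (rhsVectors p qs S a) fun _ v => v = S.map fun s =>
      ∑ x ∈ (specialize ν p).roots.toFinset, rowValue s (signVector ν qs x) := by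
  induction S with
  | nil => exact fun a _ => .pure fun _ => rfl
  | cons s S ih =>
    intro a hqs
    have hquery := isBranching_tarskiQueries ν p a (s.1.map fun l => qs.getD l 0)
      (s.2.map fun l => qs.getD l 0) fun hc h0 q hq => by
        obtain ⟨l, -, rfl⟩ := List.mem_map.1 hq
        rcases lt_or_ge l qs.length with h | h
        · rw [List.getD_eq_getElem _ _ h]
          exact hqs hc h0 _ (List.getElem_mem h)
        · rw [List.getD_eq_default _ _ h]
          simp
    refine hquery.flatMap fun b hb hQ => ?_
    refine (ih b.1 fun hc => hqs (hc.mono (hquery.subset b hb))).map (fun c => b.2 :: c.2) ?_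
    rintro a' v hba hc rfl
    have hN := hQ (hc.mono hba)
    rw [List.map_cons, hN]
    congr 1
    refine Finset.sum_congr rfl fun x _ => ?_
    simp only [rowValue, signVector_getD, List.map_map, Function.comp_def]

theorem isBranching_reduceSystem (ν : List ℝ) (p : RMPoly) (qs : List RMPoly) (a : Assumps)
    (E : MatrixEq)
    (hqs : Consistent ν a → specialize ν p = 0 → ∀ q ∈ qs, (specialize ν q).natDegree = 0)
    (hE : Consistent ν a → E.Valid qs.length)
    (hcov : Consistent ν a → ∀ x ∈ (specialize ν p).roots.toFinset, signVector ν qs x ∈ E.signs) :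
    IsBranching ν a (reduceSystem p qs a E) fun _ E' => E'.Valid qs.length ∧
      ∀ t, t ∈ E'.signs ↔ ∃ x ∈ (specialize ν p).roots.toFinset, signVector ν qs x = t := by
  refine (isBranching_rhsVectors ν p qs E.subsets a hqs).map (fun b => E.reduce (E.solve b.2)) ?_
  rintro a' v haa' hc rfl
  have hc' := hc.mono haa'
  exact (hE hc').reduce_solve _ _ (hcov hc')

/-- Both halves refer to the roots of the same `p`. The sign vector at a root thus restricts to a
listed assignment on each half, which gives the coverage needed to solve the combined system. The
hypothesis on `qs` handles a vanishing `p`, whose Tarski queries must then be zero. -/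
theorem isBranching_calculateData (ν : List ℝ) (p : RMPoly) (a : Assumps) (qs : List RMPoly) :
    (Consistent ν a → specialize ν p = 0 → ∀ q ∈ qs, (specialize ν q).natDegree = 0) →
    IsBranching ν a (calculateData p qs a) fun _ E => E.Valid qs.length ∧
      ∀ t, t ∈ E.signs ↔ ∃ x ∈ (specialize ν p).roots.toFinset, signVector ν qs x = t := by
  induction qs using calculateData.induct p a with
  | case1 qs h =>
    intro hqs
    rw [calculateData, dif_pos h]
    match qs, h with
    | [], _ =>
      exact isBranching_reduceSystem ν p [] a emptyCase hqs (fun _ => emptyCase_valid)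
        fun _ x _ => by simp [signVector, emptyCase]
    | [q], _ =>
      refine isBranching_reduceSystem ν p [q] a baseCase hqs (fun _ => baseCase_valid)
        fun _ x _ => ?_
      rcases sgn_cases ((specialize ν q).eval x) with ⟨_, e⟩ | ⟨_, e⟩ | ⟨_, e⟩ <;>
        simp [signVector, baseCase, e]
  | case2 qs h n ihl ihr =>
    intro hqs
    rw [calculateData, dif_neg h]
    have hl := ihl fun hc h0 q hq => hqs hc h0 q (List.mem_of_mem_take hq)
    have hr := ihr fun hc h0 q hq => hqs hc h0 q (List.mem_of_mem_drop hq)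
    refine hl.flatMap₂ hr fun b hb c _ hbc => ?_
    have hlen : (qs.take n).length = n := by
      rw [List.length_take]
      omega
    refine isBranching_reduceSystem ν p qs _ _
      (fun hc => hqs (hc.mono (List.Subset.trans (hl.subset b hb) (List.subset_append_left _ _))))
      (fun hc => ?_) fun hc x hx => ?_
    · obtain ⟨⟨hb, -⟩, hc, -⟩ := hbc hc
      have := (hlen ▸ hb).combine hc
      rwa [List.length_drop, Nat.add_sub_cancel' (Nat.div_le_self _ _)] at this
    · obtain ⟨⟨-, hb⟩, -, hc⟩ := hbc hc
      refine List.mem_flatMap.2 ⟨_, (hb _).2 ⟨x, hx, rfl⟩, List.mem_map.2 ⟨_, (hc _).2 ⟨x, hx, rfl⟩, ?_⟩⟩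
      rw [signVector, signVector, signVector, ← List.map_append, List.take_append_drop]

/-! ### Sample points for sign conditions -/

theorem sgn_eval_eq_of_no_root {q : ℝ[X]} {x y : ℝ} (h : ∀ z ∈ Set.uIcc x y, q.eval z ≠ 0) :
    sgn (q.eval x) = sgn (q.eval y) := by
  have hx := h x Set.left_mem_uIcc
  have hy := h y Set.right_mem_uIcc
  have hivt := intermediate_value_uIcc (f := fun z => q.eval z) (a := x) (b := y)
    q.continuous.continuousOn
  have hnot : (0 : ℝ) ∉ Set.uIcc (q.eval x) (q.eval y) := fun h0 => by
    obtain ⟨z, hz, hz0⟩ := hivt h0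
    exact h z hz hz0
  rcases lt_or_gt_of_ne hx with hx | hx <;> rcases lt_or_gt_of_ne hy with hy | hy
  · rw [sgn_of_neg hx, sgn_of_neg hy]
  · exact absurd (Set.mem_uIcc.2 (Or.inl ⟨hx.le, hy.le⟩)) hnot
  · exact absurd (Set.mem_uIcc.2 (Or.inr ⟨hy.le, hx.le⟩)) hnot
  · rw [sgn_of_pos hx, sgn_of_pos hy]

/-- If `f` has a root on either side of `x`, but does not vanish at `x`, then its derivative has a
root that is not separated from `x` by a root of `f`. -/
theorem exists_derivative_root {f : ℝ[X]} (hf : f ≠ 0) {x a b : ℝ} (hx : f.eval x ≠ 0)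
    (ha : f.IsRoot a) (hax : a ≤ x) (hb : f.IsRoot b) (hxb : x ≤ b) :
    ∃ c, (derivative f).eval c = 0 ∧ ∀ z ∈ Set.uIcc x c, f.eval z ≠ 0 := by
  classical
  have hmem : ∀ y, y ∈ f.roots.toFinset ↔ f.IsRoot y := fun y => by simp [hf]
  -- The nearest roots on either side of `x` bound a gap free of roots. Rolle places `c` inside this
  -- gap, so the segment from `x` to `c` stays in it.
  obtain ⟨a', ha', hamax⟩ := (f.roots.toFinset.filter (· ≤ x)).exists_max_image id
    ⟨a, by simp only [Finset.mem_filter, hmem]; exact ⟨ha, hax⟩⟩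
  obtain ⟨b', hb', hbmin⟩ := (f.roots.toFinset.filter (x ≤ ·)).exists_min_image id
    ⟨b, by simp only [Finset.mem_filter, hmem]; exact ⟨hb, hxb⟩⟩
  simp only [Finset.mem_filter, hmem, id, and_imp] at ha' hb' hamax hbmin
  have hax' : a' < x := lt_of_le_of_ne ha'.2 fun e => hx (e ▸ ha'.1)
  have hxb' : x < b' := lt_of_le_of_ne hb'.2 fun e => hx (e ▸ hb'.1)
  obtain ⟨c, hc, hc0⟩ := exists_deriv_eq_zero (f := fun z => f.eval z) (hax'.trans hxb')
    f.continuous.continuousOn (ha'.1.eq_zero.trans hb'.1.eq_zero.symm)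
  rw [Polynomial.deriv] at hc0
  refine ⟨c, hc0, fun z hz hz0 => ?_⟩
  have hz1 : a' < z ∧ z < b' := by
    rcases Set.mem_uIcc.1 hz with h | h
    · exact ⟨hax'.trans_le h.1, h.2.trans_lt hc.2⟩
    · exact ⟨hc.1.trans_le h.1, h.2.trans_lt hxb'⟩
  rcases le_total z x with h | h
  · exact absurd (hamax z hz0 h) (not_le.2 hz1.1)
  · exact absurd (hbmin z hz0 h) (not_le.2 hz1.2)

theorem isRoot_list_prod {Q : List ℝ[X]} {q : ℝ[X]} (hq : q ∈ Q) {y : ℝ} (hy : q.IsRoot y) :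
    Q.prod.IsRoot y :=
  hy.dvd (List.dvd_prod hq)

/-- The sign conditions realized by nonzero polynomials are those at the critical points of their
product, its roots, and those at infinity. -/
theorem exists_sample_point {Q : List ℝ[X]} (hQ : ∀ q ∈ Q, q ≠ 0) (x : ℝ) :
    (∃ y ∈ (Q.prod * derivative Q.prod).roots.toFinset,
      ∀ q ∈ Q, sgn (q.eval y) = sgn (q.eval x)) ∨
    (∀ q ∈ Q, sgn (q.eval x) = sgn q.leadingCoeff) ∨
    (∀ q ∈ Q, sgn (q.eval x) = (-1) ^ q.natDegree * sgn q.leadingCoeff) := by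
  set f := Q.prod with hf
  have hf0 : f ≠ 0 := List.prod_ne_zero fun h => hQ 0 h rfl
  by_cases hlt : ∀ y, f.IsRoot y → y < x
  · exact Or.inr (Or.inl fun q hq => sgn_eval_of_roots_lt fun y hy => hlt y (isRoot_list_prod hq hy))
  by_cases hgt : ∀ y, f.IsRoot y → x < y
  · exact Or.inr (Or.inr fun q hq => sgn_eval_of_lt_roots fun y hy => hgt y (isRoot_list_prod hq hy))
  push Not at hlt hgt
  obtain ⟨b, hb, hxb⟩ := hlt
  obtain ⟨a, ha, hax⟩ := hgt
  -- A constant `f` with a root would be zero. This matters because `roots` of a vanishing product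
  -- would be empty.
  have hd0 : derivative f ≠ 0 := fun h0 => by
    have hc := eq_C_of_natDegree_eq_zero (derivative_eq_zero.1 h0)
    rw [hc, IsRoot, eval_C] at ha
    rw [ha, C_0] at hc
    exact hf0 hc
  have hmem : ∀ y, y ∈ (f * derivative f).roots.toFinset ↔
      f.eval y = 0 ∨ (derivative f).eval y = 0 := fun y => by
    simp only [Multiset.mem_toFinset, mem_roots (mul_ne_zero hf0 hd0), IsRoot, eval_mul,
      mul_eq_zero]
  by_cases hx : f.eval x = 0
  · exact Or.inl ⟨x, (hmem x).2 (Or.inl hx), fun _ _ => rfl⟩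
  · obtain ⟨c, hc, hz⟩ := exists_derivative_root hf0 hx ha hax hb hxb
    exact Or.inl ⟨c, (hmem c).2 (Or.inr hc), fun q hq => (sgn_eval_eq_of_no_root fun z hz' h0 =>
      hz z hz' (isRoot_list_prod hq h0)).symm⟩

theorem exists_sgn_eval_eq_sgn_leadingCoeff {Q : List ℝ[X]} (hQ : ∀ q ∈ Q, q ≠ 0) :
    ∃ x, ∀ q ∈ Q, sgn (q.eval x) = sgn q.leadingCoeff := by
  have hf0 : Q.prod ≠ 0 := List.prod_ne_zero fun h => hQ 0 h rfl
  obtain ⟨M, hM⟩ := Q.prod.roots.toFinset.bddAbove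
  refine ⟨M + 1, fun q hq => sgn_eval_of_roots_lt fun y hy => ?_⟩
  have : y ≤ M := hM (by simpa [hf0] using isRoot_list_prod hq hy)
  linarith

theorem exists_sgn_eval_eq_neg_one_pow_mul {Q : List ℝ[X]} (hQ : ∀ q ∈ Q, q ≠ 0) :
    ∃ x, ∀ q ∈ Q, sgn (q.eval x) = (-1) ^ q.natDegree * sgn q.leadingCoeff := by
  have hf0 : Q.prod ≠ 0 := List.prod_ne_zero fun h => hQ 0 h rfl
  obtain ⟨M, hM⟩ := Q.prod.roots.toFinset.bddBelow
  refine ⟨M - 1, fun q hq => sgn_eval_of_lt_roots fun y hy => ?_⟩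
  have : M ≤ y := hM (by simpa [hf0] using isRoot_list_prod hq hy)
  linarith

/-! ### Correctness of sign determination -/

theorem isBranching_lcAssumps (ν : List ℝ) (q : RMPoly) (a : Assumps) :
    IsBranching ν a (lcAssumps q a) fun a' q' =>
      specialize ν q' = specialize ν q ∧ (q' = 0 ∨ LeadAssumedNonzero a' q') := by
  induction q, a using lcAssumps.induct with
  | case1 a =>
    rw [lcAssumps, dif_pos rfl]
    exact .pure fun _ => ⟨rfl, Or.inl rfl⟩
  | case2 q a hq hl ih =>
    rw [lcAssumps, dif_neg hq, hl]
    refine .trisect (L₀ := lcAssumps q.eraseLead ((q.leadingCoeff, 0) :: a))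
      (L₁ := [((q.leadingCoeff, 1) :: a, q)]) (L₂ := [((q.leadingCoeff, -1) :: a, q)])
      q.leadingCoeff (fun b => ?_) ?_
      (.pure fun _ => ⟨rfl, Or.inr ⟨1, one_ne_zero, by simp⟩⟩)
      (.pure fun _ => ⟨rfl, Or.inr ⟨-1, by norm_num, by simp⟩⟩)
    · simp only [List.mem_cons, List.not_mem_nil, or_false]
      tauto
    · refine ih.imp fun a' q' haa' hcons h => ?_
      have h0 := hcons (q.leadingCoeff, 0) (haa' (by simp))
      rwa [specialize_eraseLead (sgn_eq_zero_iff.1 h0.symm)] at h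
  | case3 q a hq hl ih =>
    rw [lcAssumps, dif_neg hq, hl]
    simp only [if_true]
    refine ih.imp fun a' q' haa' hcons h => ?_
    have h0 := hcons (q.leadingCoeff, 0) (haa' (mem_of_lookupSign hl))
    rwa [specialize_eraseLead (sgn_eq_zero_iff.1 h0.symm)] at h
  | case4 q a hq s hl hs =>
    rw [lcAssumps, dif_neg hq, hl]
    simp only [if_neg hs]
    exact .pure fun _ => ⟨rfl, Or.inr ⟨s, hs, mem_of_lookupSign hl⟩⟩

theorem isBranching_lcAssumpsList (ν : List ℝ) (qs : List RMPoly) : ∀ a : Assumps,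
    IsBranching ν a (lcAssumpsList qs a) fun a' qs' =>
      qs'.map (specialize ν) = qs.map (specialize ν) ∧
        ∀ q ∈ qs', q = 0 ∨ LeadAssumedNonzero a' q := by
  induction qs with
  | nil => exact fun a => .pure fun _ => ⟨rfl, by simp⟩
  | cons q qs ih =>
    intro a
    refine (isBranching_lcAssumps ν q a).flatMap fun b _ hb => ?_
    refine (ih b.1).map (fun c => b.2 :: c.2) ?_
    rintro a' qs' hba hc ⟨h1, h2⟩
    obtain ⟨h3, h4⟩ := hb (hc.mono hba)
    refine ⟨by rw [List.map_cons, List.map_cons, h1, h3], ?_⟩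
    rintro q' hq'
    rcases List.mem_cons.1 hq' with rfl | hq'
    · exact h4.imp_right fun h => h.mono hba
    · exact h2 q' hq'

theorem signVector_eq_map (ν : List ℝ) (qs : List RMPoly) (x : ℝ) :
    signVector ν qs x = (qs.map (specialize ν)).map fun q => sgn (q.eval x) := by
  simp [signVector]

theorem isBranching_signDetermination (ν : List ℝ) (qs : List RMPoly) (a : Assumps) :
    IsBranching ν a (signDetermination qs a) fun _ L =>
      ∀ t, t ∈ L ↔ ∃ x, signVector ν qs x = t := by
  classical
  refine (isBranching_lcAssumpsList ν qs a).flatMap fun b _ hb => ?_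
  obtain ⟨a, qs'⟩ := b
  simp only at hb ⊢
  set Q := (qs'.filter fun q => q ≠ 0).map (specialize ν) with hQdef
  have hQ : Consistent ν a → ∀ q ∈ Q, q ≠ 0 := fun hc q hq => by
    obtain ⟨r, hr, rfl⟩ := List.mem_map.1 hq
    obtain ⟨hr, hr0⟩ := List.mem_filter.1 hr
    exact specialize_ne_zero ((((hb hc).2 r hr).resolve_left (by simpa using hr0)).eval_ne_zero hc)
  have hmemQ : ∀ q ∈ qs', q ≠ 0 → specialize ν q ∈ Q := fun q hq h0 =>
    List.mem_map_of_mem (List.mem_filter.2 ⟨hq, by simpa using h0⟩)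
  have hp : specialize ν (polyP qs') = Q.prod * derivative Q.prod := by
    have hder : ∀ f : RMPoly, specialize ν (derivative f) = derivative (specialize ν f) :=
      fun f => (derivative_map f _).symm
    rw [polyP, map_mul, hder, map_list_prod]
  refine (isBranching_calculateData ν (polyP qs') a qs' fun hc h0 q hq => ?_).map
    (fun c => posLimit a qs' :: negLimit a qs' :: c.2.signs) ?_
  -- If `p` vanishes at `ν` although the product does not, then the product has zero derivative. It
  -- is constant, and so is each of its divisors.
  · rcases eq_or_ne q 0 with rfl | hq0
    · simp
    have hf0 : Q.prod ≠ 0 := List.prod_ne_zero fun h => hQ hc 0 h rfl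
    rw [hp, mul_eq_zero, or_iff_right hf0] at h0
    have := natDegree_le_of_dvd (List.dvd_prod (hmemQ q hq hq0)) hf0
    rw [derivative_eq_zero.1 h0] at this
    omega
  · rintro a' E haa' hc ⟨-, hE⟩ t
    have hc := hc.mono haa'
    have hsv : ∀ x, signVector ν qs x = signVector ν qs' x := fun x => by
      rw [signVector_eq_map, signVector_eq_map, (hb hc).1]
    -- Polynomials that are zero in the branch are left out of `Q`, but have sign `0` at every point
    -- and at both infinities. It is enough to compare signs on the nonzero ones.
    have hsvc : ∀ (x : ℝ) (g : RMPoly → ℚ), (∀ q, q = 0 → g q = 0) →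
        (∀ q ∈ qs', q ≠ 0 → sgn ((specialize ν q).eval x) = g q) →
        signVector ν qs' x = qs'.map g := by
      intro x g hg h
      refine List.map_congr_left fun q hq => ?_
      rcases eq_or_ne q 0 with rfl | hq0
      · simp [hg]
      · exact h q hq hq0
    have hpos : posLimit a qs' = qs'.map fun q => sgn (specialize ν q).leadingCoeff := by
      refine List.map_congr_left fun q hq => ?_
      rcases eq_or_ne q 0 with rfl | hq0
      · simp
      have hl := ((hb hc).2 q hq).resolve_left hq0
      rw [if_neg hq0, hl.lookupSign_eq hc, leadingCoeff_specialize (hl.eval_ne_zero hc),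
        Option.getD_some]
    have hneg : negLimit a qs' = qs'.map fun q =>
        (-1) ^ (specialize ν q).natDegree * sgn (specialize ν q).leadingCoeff := by
      refine List.map_congr_left fun q hq => ?_
      rcases eq_or_ne q 0 with rfl | hq0
      · simp
      have hl := ((hb hc).2 q hq).resolve_left hq0
      rw [if_neg hq0, hl.lookupSign_eq hc, leadingCoeff_specialize (hl.eval_ne_zero hc),
        natDegree_specialize (hl.eval_ne_zero hc), Option.getD_some]
    simp only [List.mem_cons, hE, hsv, hpos, hneg]
    constructor
    · rintro (rfl | rfl | ⟨x, -, rfl⟩)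
      · obtain ⟨x, hx⟩ := exists_sgn_eval_eq_sgn_leadingCoeff (hQ hc)
        exact ⟨x, hsvc x _ (by rintro _ rfl; simp) fun q hq h0 => hx _ (hmemQ q hq h0)⟩
      · obtain ⟨x, hx⟩ := exists_sgn_eval_eq_neg_one_pow_mul (hQ hc)
        exact ⟨x, hsvc x _ (by rintro _ rfl; simp) fun q hq h0 => hx _ (hmemQ q hq h0)⟩
      · exact ⟨x, rfl⟩
    · rintro ⟨x, rfl⟩
      rcases exists_sample_point (hQ hc) x with ⟨y, hy, h⟩ | h | h
      · refine Or.inr (Or.inr ⟨y, by rw [hp]; exact hy, ?_⟩)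
        exact hsvc y _ (by rintro _ rfl; simp) fun q hq h0 => h _ (hmemQ q hq h0)
      · exact Or.inl (hsvc x _ (by rintro _ rfl; simp) fun q hq h0 => h _ (hmemQ q hq h0))
      · exact Or.inr (Or.inl (hsvc x _ (by rintro _ rfl; simp) fun q hq h0 => h _ (hmemQ q hq h0)))

/-! ### Correctness of quantifier elimination -/

/-- Quantifier-free formulas. -/
def QuantifierFree : Fm Atom → Prop
  | .trueF => True
  | .falseF => True
  | .atom _ => True
  | .and F G => QuantifierFree F ∧ QuantifierFree G
  | .or F G => QuantifierFree F ∧ QuantifierFree G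
  | .neg F => QuantifierFree F
  | .exQ _ => False
  | .allQ _ => False
  | .exN _ _ => False
  | .allN _ _ => False

/-- Both sides are ring homomorphisms in `p`, so constants and variables suffice: variable `0`
becomes `x`, and variable `i + 1` is lowered to `i` and reads entry `i` of `ν`. -/
theorem eval_specialize_univariateIn (x : ℝ) (ν : List ℝ) (p : RealMPoly) :
    (specialize ν ((univariateIn 0 p).map lowerPoly.toRingHom)).eval x = evalMPoly (x :: ν) p := by
  have h : ((evalRingHom x).comp ((specialize ν).comp
      ((mapRingHom lowerPoly.toRingHom).comp (MvPolynomial.aeval fun i =>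
        if i = 0 then (X : RMPoly) else C (MvPolynomial.X i)).toRingHom))) = evalHom (x :: ν) := by
    refine MvPolynomial.ringHom_ext (fun r => ?_) fun i => ?_
    · have hC : algebraMap ℝ RMPoly r = C (MvPolynomial.C r) := rfl
      simp [specialize, evalHom, hC, lowerPoly]
    · cases i with
      | zero => simp [specialize, evalHom]
      | succ i => simp [specialize, evalHom, lowerPoly]
  exact RingHom.congr_fun h p

/-- Repeated polynomials are harmless, since the attached sign is a function of the polynomial. -/
theorem lookupSign_zip_map (g : RealMPoly → ℚ) {c : RealMPoly} : ∀ {qs : List RealMPoly},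
    c ∈ qs → lookupSign c (qs.zip (qs.map g)) = some (g c)
  | [], h => by simp at h
  | q :: qs, h => by
    rw [List.map_cons, List.zip_cons_cons, lookupSign]
    split_ifs with hc
    · rw [hc]
    · exact lookupSign_zip_map g ((List.mem_cons.1 h).resolve_left hc)

theorem Atom.holdsAt_sgn (A : Atom) (μ : List ℝ) :
    A.holdsAt (sgn (evalMPoly μ A.poly)) ↔ aEval A μ := by
  cases A with
  | _ p =>
    simp only [Atom.holdsAt, aEval, Atom.poly]
    rcases sgn_cases (evalMPoly μ p) with ⟨h, e⟩ | ⟨h, e⟩ | ⟨h, e⟩ <;> rw [e]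
    · simp [h, h.le, h.ne]
    · simp [h]
    · simp [h.not_gt, h.not_ge, h.ne']

theorem lookupSem_eq {qs : List RealMPoly} {μ : List ℝ} : ∀ {F : Fm Atom}, QuantifierFree F →
    extractPolys F ⊆ qs →
    lookupSem F (qs.zip (qs.map fun p => sgn (evalMPoly μ p))) = some (eval F μ)
  | .trueF, _, _ => rfl
  | .falseF, _, _ => rfl
  | .atom A, _, h => by
    rw [lookupSem, lookupSign_zip_map _ (h (by simp [extractPolys])), Option.map_some, eval,
      Atom.holdsAt_sgn]
  | .and F G, hF, h => by
    rw [extractPolys, List.append_subset] at h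
    rw [lookupSem, lookupSem_eq hF.1 h.1, lookupSem_eq hF.2 h.2]
    rfl
  | .or F G, hF, h => by
    rw [extractPolys, List.append_subset] at h
    rw [lookupSem, lookupSem_eq hF.1 h.1, lookupSem_eq hF.2 h.2]
    rfl
  | .neg F, hF, h => by
    rw [lookupSem, lookupSem_eq (F := F) hF h]
    rfl

/-- `assumpToAtom` reads every positive number as the sign `+`, whereas `Consistent` demands the
exact value; `ProperSigns` rules out the difference. -/
theorem eval_assumpsToFm {ν : List ℝ} : ∀ {a : Assumps}, ProperSigns a →
    (eval (assumpsToFm a) ν ↔ Consistent ν a)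
  | [], _ => by simp [assumpsToFm, eval, Consistent]
  | (c, s) :: t, h => by
    obtain ⟨hs, ht⟩ := List.forall_mem_cons.1 h
    have hcons : Consistent ν ((c, s) :: t) ↔ s = sgn (evalHom ν c) ∧ Consistent ν t :=
      List.forall_mem_cons
    rw [assumpsToFm, eval, eval_assumpsToFm ht, hcons]
    refine and_congr_left fun _ => ?_
    change aEval (assumpToAtom (c, s)) ν ↔ s = sgn (evalHom ν c)
    have hneg : evalMPoly ν (-c) = -evalMPoly ν c := map_neg (evalHom ν) c
    have he : evalHom ν c = evalMPoly ν c := rfl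
    simp only at hs
    rw [he]
    rcases hs with rfl | rfl | rfl <;>
      rcases sgn_cases (evalMPoly ν c) with ⟨h, e⟩ | ⟨h, e⟩ | ⟨h, e⟩ <;>
      rw [e] <;> norm_num [assumpToAtom, aEval, hneg] <;> linarith

theorem eval_disjunction {ν : List ℝ} : ∀ L : List Assumps,
    eval (disjunction L) ν ↔ ∃ a ∈ L, eval (assumpsToFm a) ν
  | [] => by simp [disjunction, eval]
  | a :: L => by simp [disjunction, eval, eval_disjunction L]

/-- A selected branch true at `ν` lists all realized sign assignments, so `F` holds everywhere.
Conversely some branch is true at `ν`; it lists only realized assignments, hence it is selected when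
`F` holds everywhere. -/
theorem eval_elimForall {F : Fm Atom} (hF : QuantifierFree F) (ν : List ℝ) :
    eval (elimForall F) ν ↔ ∀ x, eval F (x :: ν) := by
  classical
  set qs := extractPolys F with hqs
  set us := (qs.map (univariateIn 0)).map (Polynomial.map lowerPoly.toRingHom) with hus
  have hB := isBranching_signDetermination ν us []
  have hsv : ∀ x, signVector ν us x = qs.map fun p => sgn (evalMPoly (x :: ν) p) := fun x => by
    simp only [hus, signVector, List.map_map]
    refine List.map_congr_left fun p _ => ?_
    simp only [Function.comp_apply, eval_specialize_univariateIn]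
  have htest : ∀ L : List (List ℚ), (∀ t, t ∈ L ↔ ∃ x, signVector ν us x = t) →
      ((∀ s ∈ L, ∃ P : Prop, lookupSem F (qs.zip s) = some P ∧ P) ↔ ∀ x, eval F (x :: ν)) := by
    intro L hL
    have h1 : ∀ x, (∃ P : Prop, lookupSem F (qs.zip (signVector ν us x)) = some P ∧ P) ↔
        eval F (x :: ν) := fun x => by
      rw [hsv, lookupSem_eq hF (List.Subset.refl _)]
      exact ⟨fun ⟨P, hP, h⟩ => (Option.some.inj hP).symm ▸ h, fun h => ⟨_, rfl, h⟩⟩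
    simp only [hL, ← h1]
    exact ⟨fun h x => h _ ⟨x, rfl⟩, by rintro h _ ⟨x, rfl⟩; exact h x⟩
  have hproper : ∀ b ∈ signDetermination us [], ProperSigns b.1 := fun b hb =>
    hB.proper b hb (by simp [ProperSigns])
  have hiff : eval (elimForall F) ν ↔ ∃ b ∈ signDetermination us [],
      (∀ s ∈ b.2, ∃ P : Prop, lookupSem F (qs.zip s) = some P ∧ P) ∧ eval (assumpsToFm b.1) ν := by
    rw [elimForall, eval_disjunction]
    simp only [List.mem_map, List.mem_filter, decide_eq_true_eq]
    constructor
    · rintro ⟨_, ⟨b, ⟨hb, ht⟩, rfl⟩, h⟩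
      exact ⟨b, hb, ht, h⟩
    · rintro ⟨b, hb, ht, h⟩
      exact ⟨_, ⟨b, ⟨hb, ht⟩, rfl⟩, h⟩
  rw [hiff]
  constructor
  · rintro ⟨b, hb, ht, h⟩
    exact (htest _ (hB.correct b hb ((eval_assumpsToFm (hproper b hb)).1 h))).1 ht
  · intro h
    obtain ⟨b, hb, hc⟩ := hB.exists_consistent (by simp [Consistent])
    exact ⟨b, hb, (htest _ (hB.correct b hb hc)).2 h, (eval_assumpsToFm (hproper b hb)).2 hc⟩

theorem quantifierFree_assumpsToFm : ∀ a : Assumps, QuantifierFree (assumpsToFm a)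
  | [] => trivial
  | _ :: t => ⟨trivial, quantifierFree_assumpsToFm t⟩

theorem quantifierFree_disjunction : ∀ L : List Assumps, QuantifierFree (disjunction L)
  | [] => trivial
  | a :: L => ⟨quantifierFree_assumpsToFm a, quantifierFree_disjunction L⟩

theorem quantifierFree_elimForall (F : Fm Atom) : QuantifierFree (elimForall F) :=
  quantifierFree_disjunction _

theorem quantifierFree_elimExist (F : Fm Atom) : QuantifierFree (elimExist F) :=
  quantifierFree_disjunction _

theorem eval_elimExist {F : Fm Atom} (hF : QuantifierFree F) (ν : List ℝ) :
    eval (elimExist F) ν ↔ ∃ x, eval F (x :: ν) := by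
  rw [elimExist, eval, eval_elimForall (F := .neg F) hF]
  simp [eval]

theorem quantifierFree_iterate {f : Fm Atom → Fm Atom} (hf : ∀ F, QuantifierFree (f F)) {F : Fm Atom}
    (hF : QuantifierFree F) : ∀ n, QuantifierFree (f^[n] F)
  | 0 => hF
  | n + 1 => by
    rw [Function.iterate_succ_apply']
    exact hf _

theorem eval_iterate_elimForall (ν : List ℝ) (n : ℕ) : ∀ F : Fm Atom, QuantifierFree F →
    (eval (elimForall^[n] F) ν ↔ ∀ L : List ℝ, L.length = n → eval F (L ++ ν)) := by
  induction n with
  | zero => simp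
  | succ n ih =>
    intro F hF
    -- The first elimination applied removes variable `0`, the head of the prepended list; the
    -- remaining `n` are covered by induction for `elimForall F`.
    rw [Function.iterate_succ_apply, ih _ (quantifierFree_elimForall F)]
    simp only [eval_elimForall hF]
    constructor
    · rintro h (_ | ⟨x, L⟩) hL
      · simp at hL
      · exact h L (by simpa using hL) x
    · exact fun h L hL x => h (x :: L) (by simp [hL])

theorem eval_iterate_elimExist (ν : List ℝ) (n : ℕ) : ∀ F : Fm Atom, QuantifierFree F →
    (eval (elimExist^[n] F) ν ↔ ∃ L : List ℝ, L.length = n ∧ eval F (L ++ ν)) := by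
  induction n with
  | zero => simp
  | succ n ih =>
    intro F hF
    rw [Function.iterate_succ_apply, ih _ (quantifierFree_elimExist F)]
    simp only [eval_elimExist hF]
    constructor
    · rintro ⟨L, hL, x, h⟩
      exact ⟨x :: L, by simp [hL], h⟩
    · rintro ⟨_ | ⟨x, L⟩, hL, h⟩
      · simp at hL
      · exact ⟨L, by simpa using hL, x, h⟩

theorem quantifierFree_qe : ∀ F : Fm Atom, QuantifierFree (qe F)
  | .trueF => trivial
  | .falseF => trivial
  | .atom _ => trivial
  | .and F G => ⟨quantifierFree_qe F, quantifierFree_qe G⟩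
  | .or F G => ⟨quantifierFree_qe F, quantifierFree_qe G⟩
  | .neg F => quantifierFree_qe F
  | .exQ F => quantifierFree_elimExist (qe F)
  | .allQ F => quantifierFree_elimForall (qe F)
  | .exN n F => quantifierFree_iterate quantifierFree_elimExist (quantifierFree_qe F) n
  | .allN n F => quantifierFree_iterate quantifierFree_elimForall (quantifierFree_qe F) n

theorem eval_qe (F : Fm Atom) : ∀ ν : List ℝ, eval (qe F) ν ↔ eval F ν := by
  induction F with
  | trueF => exact fun _ => Iff.rfl
  | falseF => exact fun _ => Iff.rfl
  | atom A => exact fun _ => Iff.rfl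
  | and F G hF hG => exact fun ν => and_congr (hF ν) (hG ν)
  | or F G hF hG => exact fun ν => or_congr (hF ν) (hG ν)
  | neg F hF => exact fun ν => not_congr (hF ν)
  | exQ F hF =>
    intro ν
    rw [qe, eval_elimExist (quantifierFree_qe F), eval]
    simp only [hF]
  | allQ F hF =>
    intro ν
    rw [qe, eval_elimForall (quantifierFree_qe F), eval]
    simp only [hF]
  | exN n F hF =>
    intro ν
    rw [qe, eval_iterate_elimExist ν n _ (quantifierFree_qe F), eval]
    simp only [hF]
  | allN n F hF =>
    intro ν
    rw [qe, eval_iterate_elimForall ν n _ (quantifierFree_qe F), eval]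
    simp only [hF]

end HybridQE

end

/-- Every formula of first-order real arithmetic has the same truth value as the output of the
quantifier elimination procedure, under every valuation of the free variables. -/
theorem mainTheorem1 (F : HybridQE.Fm HybridQE.Atom) (ν : List ℝ) :
    HybridQE.eval F ν ↔ HybridQE.eval (HybridQE.qe F) ν :=
  (HybridQE.eval_qe F ν).symm
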